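/- Let $d\ge 2$. Equip $\mathbb R^d$ with the $\ell^1$ norm $\|\cdot\|$ and let $G$ be the semigroup of real $d\times d$ matrices with nonnegative entries having a strictly positive entry in every row and in every column, with the operator norm $\|g\|=\sup_{\|x\|=1}\|gx\|$ and the topology inherited from it. Let $G^+\subset G$ be the set of matrices all of whose entries are strictly positive, and $S^+=\{x\in\mathbb R^d:\|x\|=1,\ x_i\ge 0\ \forall i\}$. For $g\in G$ and $x\in S^+$ put $g\cdot x=gx/\|gx\|$, $\sigma(g,x)=\log\|gx\|$, $v(g)=\inf_{x\in S^+}\|gx\|$, $N(g)=\max(\|g\|,1/v(g))$, and let $\kappa(g)$ be the spectral radius of $g$. Let $\mu$ be a Borel probability measure on $G$ that is strictly contracting, i.e. $\mu^{*r}(G^+)>0$ for some integer $r\ge 1$, and admits a moment of order $1$, i.e. $\int_G\log N(g)\,d\mu(g)<\infty$. Let $Y_1,Y_2,\dots$ be i.i.d. random variables with values in $G$ and law $\mu$, defined on a probability space $(\Omega,\mathbb P)$, and put $A_n=Y_n\cdots Y_1$. Then there is a unique Borel probability measure $\nu$ on $S^+$ that is $\mu$-invariant, i.e. $\int_{G\times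 S^+}\varphi(g\cdot x)\,d\mu(g)\,d\nu(x)=\int_{S^+}\varphi\,d\nu$ for every Borel function $\varphi\ge 0$ on $S^+$; the function $\sigma$ is $\mu\otimes\nu$-integrable; and, with $$\lambda_\mu:=\int_{G\times S^+}\sigma(g,x)\,d\mu(g)\,d\nu(x),$$ the following hold. 1. For every $x\in S^+$, the random variables $\frac{\sigma(A_n,x)}n$, $\frac{\log\|A_n\|}n$, $\frac{\log v(A_n)}n$ and $\frac{\log\kappa(A_n)}n$ are integrable for every $n\ge 1$ and, as $n\to\infty$, all converge to $\lambda_\mu$, both $\mathbb P$-almost surely and in $L^1(\mathbb P)$. 2. The convergence is uniform in $x\in S^+$: the random variables $\sup_{x\in S^+}\left|\frac{\sigma(A_n,x)}n-\lambda_\mu\right|$ are integrable for every $n\ge 1$, and $$\Big\|\sup_{x\in S^+}\Big|\frac{\sigma(A_n,x)}n-\lambda_\mu\Big|\Big\|_{L^1(\mathbb P)}\longrightarrow 0\quad\text{and}\quad \sup_{x\in S^+}\Big|\frac{\sigma(A_n,x)}n-\lambda_\mu\Big|\longrightarrow 0\ \ \mathbb P\text{-a.s.}$$ -/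

import Mathlib

open MeasureTheory ProbabilityTheory Filter Topology
open scoped ENNReal Matrix

namespace PosMat

noncomputable section

/-- The `ℓ¹` norm on `ℝ^d`. -/
def l1Norm {d : ℕ} (x : Fin d → ℝ) : ℝ := ∑ i, |x i|

/-- A real square matrix is positive and allowable if all its entries are nonnegative and every
row and every column contains a strictly positive entry. -/
structure IsAllowable {d : ℕ} (g : Matrix (Fin d) (Fin d) ℝ) : Prop where
  nonneg : ∀ i j, 0 ≤ g i j
  row : ∀ i, ∃ j, 0 < g i j
  col : ∀ j, ∃ i, 0 < g i j

theorem IsAllowable.mul {d : ℕ} {g h : Matrix (Fin d) (Fin d) ℝ}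
    (hg : IsAllowable g) (hh : IsAllowable h) : IsAllowable (g * h) := by
  have key : ∀ i k j, 0 < g i k → 0 < h k j → 0 < (g * h) i j := by
    intro i k j h1 h2
    rw [Matrix.mul_apply]
    exact Finset.sum_pos' (fun l _ => mul_nonneg (hg.nonneg i l) (hh.nonneg l j))
      ⟨k, Finset.mem_univ k, mul_pos h1 h2⟩
  refine ⟨fun i j => ?_, fun i => ?_, fun j => ?_⟩
  · rw [Matrix.mul_apply]
    exact Finset.sum_nonneg fun l _ => mul_nonneg (hg.nonneg i l) (hh.nonneg l j)
  · obtain ⟨k, hk⟩ := hg.row i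
    obtain ⟨j, hj⟩ := hh.row k
    exact ⟨j, key i k j hk hj⟩
  · obtain ⟨k, hk⟩ := hh.col j
    obtain ⟨i, hi⟩ := hg.col k
    exact ⟨i, key i k j hi hk⟩

theorem isAllowable_one (d : ℕ) : IsAllowable (1 : Matrix (Fin d) (Fin d) ℝ) := by
  refine ⟨fun i j => ?_, fun i => ⟨i, by simp⟩, fun j => ⟨j, by simp⟩⟩
  rw [Matrix.one_apply]
  split_ifs <;> norm_num

/-- The semigroup `G` of positive allowable `d × d` matrices (it contains the identity), with the
topology inherited from the space of matrices. -/
def G (d : ℕ) : Submonoid (Matrix (Fin d) (Fin d) ℝ) where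
  carrier := {g | IsAllowable g}
  mul_mem' := fun hg hh => IsAllowable.mul hg hh
  one_mem' := isAllowable_one d

instance instMeasurableSpaceG (d : ℕ) : MeasurableSpace (G d) := borel (G d)

instance instBorelSpaceG (d : ℕ) : BorelSpace (G d) := ⟨rfl⟩

instance instSecondCountableTopologyG (d : ℕ) : SecondCountableTopology (G d) :=
  haveI : SecondCountableTopology (Matrix (Fin d) (Fin d) ℝ) :=
    inferInstanceAs (SecondCountableTopology (Fin d → Fin d → ℝ))
  TopologicalSpace.Subtype.secondCountableTopology _

/-- `G⁺`: the matrices all of whose entries are strictly positive. -/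
def GPlus (d : ℕ) : Set (G d) := {g | ∀ i j, 0 < g.1 i j}

/-- `S⁺`: the vectors of `ℓ¹` norm one with nonnegative coordinates. As a subtype it carries the
usual Borel σ-algebra; the projective metric of `S⁺` induces the usual topology on each of the
finitely many sets of vectors with a given support, and these sets are usual Borel sets that are
open and closed for the projective metric, so both topologies have the same Borel sets. -/
def SPlus (d : ℕ) : Set (Fin d → ℝ) := {x | l1Norm x = 1 ∧ ∀ i, 0 ≤ x i}

/-- The operator norm `‖g‖ = sup_{‖x‖ = 1} ‖g x‖` associated with the `ℓ¹` norm. -/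
def opNorm {d : ℕ} (g : G d) : ℝ :=
  ⨆ x : {x : Fin d → ℝ // l1Norm x = 1}, l1Norm (g.1 *ᵥ x.1)

/-- `v(g) = inf_{x ∈ S⁺} ‖g x‖`. -/
def v {d : ℕ} (g : G d) : ℝ := ⨅ x : SPlus d, l1Norm (g.1 *ᵥ x.1)

/-- `N(g) = max (‖g‖, 1 / v(g))`. -/
def N {d : ℕ} (g : G d) : ℝ := max (opNorm g) (1 / v g)

/-- `κ(g)`: the spectral radius of `g`, i.e. the largest modulus of a complex eigenvalue. -/
def kappa {d : ℕ} (g : G d) : ℝ :=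
  (spectralRadius ℂ (g.1.map Complex.ofReal)).toReal

/-- The norm cocycle `σ(g, x) = log ‖g x‖`. -/
def cocycle {d : ℕ} (g : G d) (x : SPlus d) : ℝ := Real.log (l1Norm (g.1 *ᵥ x.1))

theorem l1Norm_mulVec_pos {d : ℕ} (g : G d) (x : SPlus d) : 0 < l1Norm (g.1 *ᵥ x.1) := by
  obtain ⟨x, hx1, hx0⟩ := x
  have hg : IsAllowable g.1 := g.2
  have hj : ∃ j, 0 < x j := by
    by_contra! h
    have h0 : ∀ j, x j = 0 := fun j => le_antisymm (h j) (hx0 j)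
    simp [l1Norm, h0] at hx1
  obtain ⟨j, hj⟩ := hj
  obtain ⟨i, hi⟩ := hg.col j
  have hpos : 0 < (g.1 *ᵥ x) i :=
    Finset.sum_pos' (fun l _ => mul_nonneg (hg.nonneg i l) (hx0 l))
      ⟨j, Finset.mem_univ j, mul_pos hi hj⟩
  exact Finset.sum_pos' (fun l _ => abs_nonneg _) ⟨i, Finset.mem_univ i, abs_pos.2 hpos.ne'⟩

/-- The action `g · x = g x / ‖g x‖` of `G` on `S⁺`. -/
def act {d : ℕ} (g : G d) (x : SPlus d) : SPlus d :=
  ⟨(l1Norm (g.1 *ᵥ x.1))⁻¹ • (g.1 *ᵥ x.1), by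
    have hpos := l1Norm_mulVec_pos g x
    have hg : IsAllowable g.1 := g.2
    refine ⟨?_, fun i => ?_⟩
    · have h : ∀ (c : ℝ) (y : Fin d → ℝ), l1Norm (c • y) = |c| * l1Norm y := by
        intro c y
        simp [l1Norm, abs_mul, Finset.mul_sum]
      rw [h, abs_of_pos (inv_pos.2 hpos), inv_mul_cancel₀ hpos.ne']
    · have h : 0 ≤ (g.1 *ᵥ x.1) i := by
        rw [Matrix.mulVec_eq_sum, Finset.sum_apply]
        exact Finset.sum_nonneg fun l _ => mul_nonneg (hg.nonneg i l) (x.2.2 l)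
      exact mul_nonneg (inv_pos.2 hpos).le h⟩

/-- `μ` admits a moment of order `p`: `∫ (log N(g))^p dμ(g) < ∞` (note that `N(g) ≥ 1`). -/
def HasMoment {d : ℕ} (μ : Measure (G d)) (p : ℝ) : Prop :=
  ∫⁻ g, ENNReal.ofReal (Real.log (N g) ^ p) ∂μ < ∞

/-- Convolution powers `μ^{*n}` of a measure on `G`. -/
def convPow {d : ℕ} (μ : Measure (G d)) : ℕ → Measure (G d)
  | 0 => Measure.dirac 1
  | n + 1 => (convPow μ n).mconv μ

/-- `μ` is strictly contracting: `μ^{*r}(G⁺) > 0` for some `r ≥ 1`. -/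
def StrictlyContracting {d : ℕ} (μ : Measure (G d)) : Prop :=
  ∃ r : ℕ, 1 ≤ r ∧ 0 < convPow μ r (GPlus d)

/-- `ν` is a `μ`-invariant Borel probability on `S⁺`. -/
def IsInvariantProb {d : ℕ} (μ : Measure (G d)) (ν : Measure (SPlus d)) : Prop :=
  IsProbabilityMeasure ν ∧
    ∀ f : SPlus d → ℝ≥0∞, Measurable f →
      ∫⁻ q : G d × SPlus d, f (act q.1 q.2) ∂(μ.prod ν) = ∫⁻ x, f x ∂ν

/-- `∫_{G × S⁺} σ(g, x) dμ(g) dν(x)`. -/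
def lyapunov {d : ℕ} (μ : Measure (G d)) (ν : Measure (SPlus d)) : ℝ :=
  ∫ q : G d × SPlus d, cocycle q.1 q.2 ∂(μ.prod ν)

/-- The left products `A_n = Y_n ⋯ Y_1`; the sequence `Y_1, Y_2, …` is indexed from `0` here, so
that `A_0 = 1` and `A_{n+1} = Y n * A_n`. -/
def leftProd {d : ℕ} {Ω : Type*} (Y : ℕ → Ω → G d) : ℕ → Ω → G d
  | 0, _ => 1
  | n + 1, ω => Y n ω * leftProd Y n ω

/-- The real random variables `X_n` converge almost surely and in `L¹` to the constant `c`. -/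
def TendstoAsAndL1 {Ω : Type*} [MeasurableSpace Ω] (P : Measure Ω) (X : ℕ → Ω → ℝ) (c : ℝ) :
    Prop :=
  (∀ᵐ ω ∂P, Tendsto (fun n => X n ω) atTop (𝓝 c)) ∧
    (∀ n, MemLp (X n) 1 P) ∧
    Tendsto (fun n => eLpNorm (fun ω => X n ω - c) 1 P) atTop (𝓝 0)

end

end PosMat

namespace PosMat

open scoped BoundedContinuousFunction

set_option linter.unusedSectionVars false

noncomputable section

/-! On nonnegative vectors the `ℓ¹` norm of `g x` is the average of the column sums of `g` with
weights `x`. Hence `opNorm g` and `v g` are the largest and smallest column sums, and `cocycle g x`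
and `log (kappa g)` both lie between `log (v g)` and `log (opNorm g)`. It is enough to find the
growth rate of these two extremes and to see that it is `lyapunov μ ν`.

Both `log (opNorm g)` and `-log (v g)` are subadditive. Cutting `A_n` into independent blocks of
length `m` and applying the strong law to the blocks bounds `log (opNorm A_n) / n` asymptotically by
its mean under `μ^{*m}` divided by `m`, and `log (v A_n) / n` from below likewise
(`IsIIDSeq.ae_exists_upper`). The two means squeeze together as `m` grows
(`IsIIDSeq.tendsto_mean_log_ratio`): almost surely some `A_k` is positive, it stays as a right
factor of every later `A_n`, and it keeps the columns of `A_n` comparable. By the cocycle identity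
and invariance of `ν`, the mean of `σ(A_m, x)` is `m` times `lyapunov μ ν`, so this exponent lies
between the two means for every `m`. No subadditive ergodic theorem is used. Convergence in `L¹`
comes from domination by the averages of `log N (Y_i)`, which are uniformly integrable.

The invariant measure comes from the products in reverse order. The image of `S⁺` under `Y_0 ⋯
Y_{n-1}` shrinks as `n` grows, and `colOsc`, which bounds its diameter, contracts in mean over
blocks of fixed length (`exists_lintegral_colOsc_contraction`). So these images collapse almost
surely to one random point. Its law `ν` is the limit of the law of `g · x` under `μ^{*n}` for every
starting point, which gives existence and uniqueness together.

Uniformity in `x` costs nothing: the supremum over `x` is the larger of the deviations of the two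
extremes, both attained at basis vectors (`iSup_enorm_cocycle_eq`). -/

/-! ### Column sums, the operator norm and `v` -/

/-- The sum of the entries of the `j`-th column. -/
def colSum {d : ℕ} (g : G d) (j : Fin d) : ℝ := ∑ i, g.1 i j

theorem G_nonneg {d : ℕ} (g : G d) (i j : Fin d) : 0 ≤ g.1 i j := IsAllowable.nonneg g.2 i j

theorem colSum_pos {d : ℕ} (g : G d) (j : Fin d) : 0 < colSum g j := by
  obtain ⟨i, hi⟩ := IsAllowable.col g.2 j
  exact Finset.sum_pos' (fun l _ => G_nonneg g l j) ⟨i, Finset.mem_univ i, hi⟩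

theorem colSum_one {d : ℕ} (j : Fin d) : colSum (1 : G d) j = 1 := by
  simp [colSum, Matrix.one_apply]

theorem colSum_mul {d : ℕ} (g h : G d) (j : Fin d) :
    colSum (g * h) j = ∑ k, colSum g k * h.1 k j := by
  simp only [colSum, Submonoid.coe_mul, Matrix.mul_apply, Finset.sum_mul]
  exact Finset.sum_comm

theorem l1Norm_mulVec_le {d : ℕ} (g : G d) (x : Fin d → ℝ) :
    l1Norm (g.1 *ᵥ x) ≤ ∑ j, colSum g j * |x j| := by
  calc l1Norm (g.1 *ᵥ x) ≤ ∑ i, ∑ j, g.1 i j * |x j| := by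
        refine Finset.sum_le_sum fun i _ => ?_
        refine (Finset.abs_sum_le_sum_abs (fun j => g.1 i j * x j) Finset.univ).trans
          (Finset.sum_le_sum fun j _ => ?_)
        rw [abs_mul, abs_of_nonneg (G_nonneg g i j)]
    _ = ∑ j, colSum g j * |x j| := by
        rw [Finset.sum_comm]
        simp only [colSum, Finset.sum_mul]

theorem l1Norm_mulVec_eq {d : ℕ} (g : G d) {x : Fin d → ℝ} (hx : ∀ i, 0 ≤ x i) :
    l1Norm (g.1 *ᵥ x) = ∑ j, colSum g j * x j := by
  have h : ∀ i, |(g.1 *ᵥ x) i| = ∑ j, g.1 i j * x j := fun i =>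
    abs_of_nonneg (a := ∑ j, g.1 i j * x j)
      (Finset.sum_nonneg fun j _ => mul_nonneg (G_nonneg g i j) (hx j))
  simp only [l1Norm, h, colSum, Finset.sum_mul]
  exact Finset.sum_comm

theorem SPlus_sum {d : ℕ} (x : SPlus d) : ∑ j, x.1 j = 1 := by
  rw [← x.2.1]
  exact Finset.sum_congr rfl fun j _ => (abs_of_nonneg (x.2.2 j)).symm

/-- The standard basis vectors, as points of `S⁺`. -/
def basisVec {d : ℕ} (j : Fin d) : SPlus d :=
  ⟨Pi.single j 1, by
    refine ⟨?_, fun i => ?_⟩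
    · simp [l1Norm, Pi.single_apply, apply_ite abs]
    · rw [Pi.single_apply]
      split_ifs <;> norm_num⟩

theorem l1Norm_mulVec_basisVec {d : ℕ} (g : G d) (j : Fin d) :
    l1Norm (g.1 *ᵥ (basisVec j).1) = colSum g j := by
  rw [l1Norm_mulVec_eq g (basisVec j).2.2]
  simp [basisVec, Pi.single_apply]

instance {d : ℕ} [NeZero d] : Nonempty (SPlus d) := ⟨basisVec 0⟩

/-- The triangle inequality bounds `‖g x‖` by an average of column sums with weights `|x j|`; each
column sum is attained at a basis vector. With finitely many columns, measurability and attainment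
become immediate. -/
theorem opNorm_eq {d : ℕ} [NeZero d] (g : G d) : opNorm g = ⨆ j, colSum g j := by
  have hb : BddAbove (Set.range (colSum g)) := Set.finite_range _ |>.bddAbove
  have key : ∀ x : {x : Fin d → ℝ // l1Norm x = 1}, l1Norm (g.1 *ᵥ x.1) ≤ ⨆ j, colSum g j := by
    intro x
    refine (l1Norm_mulVec_le g x.1).trans ?_
    calc ∑ j, colSum g j * |x.1 j| ≤ ∑ j, (⨆ j, colSum g j) * |x.1 j| :=
          Finset.sum_le_sum fun j _ => mul_le_mul_of_nonneg_right (le_ciSup hb j) (abs_nonneg _)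
      _ = ⨆ j, colSum g j := by
          rw [← Finset.mul_sum]
          exact (congrArg _ x.2).trans (mul_one _)
  have : Nonempty {x : Fin d → ℝ // l1Norm x = 1} := ⟨⟨_, (basisVec 0).2.1⟩⟩
  refine le_antisymm (ciSup_le key) (ciSup_le fun j => ?_)
  rw [← l1Norm_mulVec_basisVec]
  exact le_ciSup (f := fun x : {x : Fin d → ℝ // l1Norm x = 1} => l1Norm (g.1 *ᵥ x.1))
    ⟨_, Set.forall_mem_range.2 key⟩ ⟨_, (basisVec j).2.1⟩

theorem v_eq {d : ℕ} [NeZero d] (g : G d) : v g = ⨅ j, colSum g j := by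
  have hb : BddBelow (Set.range (colSum g)) := Set.finite_range _ |>.bddBelow
  have key : ∀ x : SPlus d, ⨅ j, colSum g j ≤ l1Norm (g.1 *ᵥ x.1) := by
    intro x
    rw [l1Norm_mulVec_eq g x.2.2]
    calc ⨅ j, colSum g j = ∑ j, (⨅ j, colSum g j) * x.1 j := by
          rw [← Finset.mul_sum, SPlus_sum, mul_one]
      _ ≤ ∑ j, colSum g j * x.1 j :=
          Finset.sum_le_sum fun j _ => mul_le_mul_of_nonneg_right (ciInf_le hb j) (x.2.2 j)
  refine le_antisymm (le_ciInf fun j => ?_) (le_ciInf key)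
  rw [← l1Norm_mulVec_basisVec]
  exact ciInf_le (f := fun x : SPlus d => l1Norm (g.1 *ᵥ x.1))
    ⟨_, Set.forall_mem_range.2 key⟩ (basisVec j)

theorem colSum_le_opNorm {d : ℕ} [NeZero d] (g : G d) (j : Fin d) : colSum g j ≤ opNorm g := by
  rw [opNorm_eq]
  exact le_ciSup (Set.finite_range _).bddAbove j

theorem v_le_colSum {d : ℕ} [NeZero d] (g : G d) (j : Fin d) : v g ≤ colSum g j := by
  rw [v_eq]
  exact ciInf_le (Set.finite_range _).bddBelow j

theorem exists_colSum_eq_opNorm {d : ℕ} [NeZero d] (g : G d) : ∃ j, colSum g j = opNorm g := by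
  rw [opNorm_eq]
  exact exists_eq_ciSup_of_finite

theorem exists_colSum_eq_v {d : ℕ} [NeZero d] (g : G d) : ∃ j, colSum g j = v g := by
  rw [v_eq]
  exact exists_eq_ciInf_of_finite

theorem v_pos {d : ℕ} [NeZero d] (g : G d) : 0 < v g := by
  obtain ⟨j, hj⟩ := exists_colSum_eq_v g
  exact hj ▸ colSum_pos g j

theorem v_le_opNorm {d : ℕ} [NeZero d] (g : G d) : v g ≤ opNorm g :=
  (v_le_colSum g 0).trans (colSum_le_opNorm g 0)

theorem opNorm_pos {d : ℕ} [NeZero d] (g : G d) : 0 < opNorm g := (v_pos g).trans_le (v_le_opNorm g)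

theorem l1Norm_mulVec_le_opNorm {d : ℕ} [NeZero d] (g : G d) (x : SPlus d) :
    l1Norm (g.1 *ᵥ x.1) ≤ opNorm g := by
  rw [l1Norm_mulVec_eq g x.2.2]
  calc ∑ j, colSum g j * x.1 j ≤ ∑ j, opNorm g * x.1 j :=
        Finset.sum_le_sum fun j _ =>
          mul_le_mul_of_nonneg_right (colSum_le_opNorm g j) (x.2.2 j)
    _ = opNorm g := by rw [← Finset.mul_sum, SPlus_sum, mul_one]

theorem v_le_l1Norm_mulVec {d : ℕ} [NeZero d] (g : G d) (x : SPlus d) :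
    v g ≤ l1Norm (g.1 *ᵥ x.1) := by
  rw [l1Norm_mulVec_eq g x.2.2]
  calc v g = ∑ j, v g * x.1 j := by rw [← Finset.mul_sum, SPlus_sum, mul_one]
    _ ≤ ∑ j, colSum g j * x.1 j :=
        Finset.sum_le_sum fun j _ => mul_le_mul_of_nonneg_right (v_le_colSum g j) (x.2.2 j)

theorem opNorm_mul_le {d : ℕ} [NeZero d] (g h : G d) : opNorm (g * h) ≤ opNorm g * opNorm h := by
  obtain ⟨j, hj⟩ := exists_colSum_eq_opNorm (g * h)
  rw [← hj, colSum_mul]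
  calc ∑ k, colSum g k * h.1 k j ≤ ∑ k, opNorm g * h.1 k j :=
        Finset.sum_le_sum fun k _ =>
          mul_le_mul_of_nonneg_right (colSum_le_opNorm g k) (G_nonneg h k j)
    _ = opNorm g * colSum h j := by rw [← Finset.mul_sum, colSum]
    _ ≤ opNorm g * opNorm h :=
        mul_le_mul_of_nonneg_left (colSum_le_opNorm h j) (opNorm_pos g).le

theorem mul_v_le {d : ℕ} [NeZero d] (g h : G d) : v g * v h ≤ v (g * h) := by
  obtain ⟨j, hj⟩ := exists_colSum_eq_v (g * h)
  rw [← hj, colSum_mul]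
  calc v g * v h ≤ v g * colSum h j :=
        mul_le_mul_of_nonneg_left (v_le_colSum h j) (v_pos g).le
    _ = ∑ k, v g * h.1 k j := by rw [← Finset.mul_sum, colSum]
    _ ≤ ∑ k, colSum g k * h.1 k j :=
        Finset.sum_le_sum fun k _ =>
          mul_le_mul_of_nonneg_right (v_le_colSum g k) (G_nonneg h k j)

theorem opNorm_one {d : ℕ} [NeZero d] : opNorm (1 : G d) = 1 := by
  simp [opNorm_eq, colSum_one]

theorem v_one {d : ℕ} [NeZero d] : v (1 : G d) = 1 := by
  simp [v_eq, colSum_one]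

theorem log_opNorm_mul_le {d : ℕ} [NeZero d] (g h : G d) :
    Real.log (opNorm (g * h)) ≤ Real.log (opNorm g) + Real.log (opNorm h) := by
  rw [← Real.log_mul (opNorm_pos g).ne' (opNorm_pos h).ne']
  exact Real.log_le_log (opNorm_pos _) (opNorm_mul_le g h)

/-- This makes `-log v` subadditive, so one upper-bound argument serves for both extremes. -/
theorem log_v_mul_ge {d : ℕ} [NeZero d] (g h : G d) :
    Real.log (v g) + Real.log (v h) ≤ Real.log (v (g * h)) := by
  rw [← Real.log_mul (v_pos g).ne' (v_pos h).ne']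
  exact Real.log_le_log (mul_pos (v_pos g) (v_pos h)) (mul_v_le g h)

theorem log_v_le_log_opNorm {d : ℕ} [NeZero d] (g : G d) :
    Real.log (v g) ≤ Real.log (opNorm g) := Real.log_le_log (v_pos g) (v_le_opNorm g)

theorem log_N_eq {d : ℕ} [NeZero d] (g : G d) :
    Real.log (N g) = max (Real.log (opNorm g)) (-Real.log (v g)) := by
  have h := Real.strictMonoOn_log.monotoneOn.map_max (opNorm_pos g) (one_div_pos.2 (v_pos g))
  rw [N, h, one_div, Real.log_inv]

theorem log_opNorm_le_log_N {d : ℕ} [NeZero d] (g : G d) :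
    Real.log (opNorm g) ≤ Real.log (N g) := by
  rw [log_N_eq]
  exact le_max_left _ _

theorem neg_log_v_le_log_N {d : ℕ} [NeZero d] (g : G d) :
    -Real.log (v g) ≤ Real.log (N g) := by
  rw [log_N_eq]
  exact le_max_right _ _

theorem abs_le_log_N {d : ℕ} [NeZero d] (g : G d) {t : ℝ} (h1 : Real.log (v g) ≤ t)
    (h2 : t ≤ Real.log (opNorm g)) : |t| ≤ Real.log (N g) :=
  abs_le.2 ⟨by linarith [neg_log_v_le_log_N g], h2.trans (log_opNorm_le_log_N g)⟩

theorem log_N_nonneg {d : ℕ} [NeZero d] (g : G d) : 0 ≤ Real.log (N g) :=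
  (abs_nonneg _).trans (abs_le_log_N g le_rfl (log_v_le_log_opNorm g))

theorem log_N_mul_le {d : ℕ} [NeZero d] (g h : G d) :
    Real.log (N (g * h)) ≤ Real.log (N g) + Real.log (N h) := by
  rw [log_N_eq (g * h)]
  refine max_le ?_ ?_
  · linarith [log_opNorm_mul_le g h, log_opNorm_le_log_N g, log_opNorm_le_log_N h]
  · linarith [log_v_mul_ge g h, neg_log_v_le_log_N g, neg_log_v_le_log_N h]

theorem log_N_one {d : ℕ} [NeZero d] : Real.log (N (1 : G d)) = 0 := by
  simp [log_N_eq, opNorm_one, v_one]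

theorem log_v_le_cocycle {d : ℕ} [NeZero d] (g : G d) (x : SPlus d) :
    Real.log (v g) ≤ cocycle g x := Real.log_le_log (v_pos g) (v_le_l1Norm_mulVec g x)

theorem cocycle_le_log_opNorm {d : ℕ} [NeZero d] (g : G d) (x : SPlus d) :
    cocycle g x ≤ Real.log (opNorm g) :=
  Real.log_le_log (l1Norm_mulVec_pos g x) (l1Norm_mulVec_le_opNorm g x)

theorem cocycle_basisVec {d : ℕ} (g : G d) (j : Fin d) :
    cocycle g (basisVec j) = Real.log (colSum g j) := by
  rw [cocycle, l1Norm_mulVec_basisVec]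

/-! ### The action -/

theorem l1Norm_smul {d : ℕ} (c : ℝ) (y : Fin d → ℝ) : l1Norm (c • y) = |c| * l1Norm y := by
  simp [l1Norm, abs_mul, Finset.mul_sum]

theorem cocycle_mul {d : ℕ} (g h : G d) (x : SPlus d) :
    cocycle (g * h) x = cocycle g (act h x) + cocycle h x := by
  have hp := l1Norm_mulVec_pos h x
  have hq := l1Norm_mulVec_pos g (act h x)
  rw [cocycle, cocycle, cocycle, ← Real.log_mul hq.ne' hp.ne']
  congr 1
  simp only [act, Matrix.mulVec_smul, l1Norm_smul, Submonoid.coe_mul, ← Matrix.mulVec_mulVec]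
  rw [abs_of_pos (inv_pos.2 hp)]
  field_simp

theorem act_mul {d : ℕ} (g h : G d) (x : SPlus d) : act (g * h) x = act g (act h x) := by
  have hp := l1Norm_mulVec_pos h x
  have hq := l1Norm_mulVec_pos (g * h) x
  ext1
  simp only [act, Matrix.mulVec_smul, l1Norm_smul, Submonoid.coe_mul, ← Matrix.mulVec_mulVec,
    smul_smul]
  rw [abs_of_pos (inv_pos.2 hp)]
  congr 1
  simp only [Submonoid.coe_mul, ← Matrix.mulVec_mulVec] at hq
  field_simp

theorem act_one {d : ℕ} (x : SPlus d) : act 1 x = x := by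
  ext1
  simp [act, x.2.1]

/-! ### Continuity and measurability -/

theorem continuous_entry {d : ℕ} (i j : Fin d) : Continuous fun g : G d => g.1 i j :=
  (continuous_apply j).comp ((continuous_apply i).comp continuous_subtype_val)

theorem continuous_colSum {d : ℕ} (j : Fin d) : Continuous fun g : G d => colSum g j :=
  continuous_finsetSum _ fun i _ => continuous_entry i j

theorem measurable_opNorm {d : ℕ} [NeZero d] : Measurable (opNorm : G d → ℝ) := by
  have : (opNorm : G d → ℝ) = fun g => ⨆ j, colSum g j := funext opNorm_eq
  rw [this]
  exact Measurable.iSup fun j => (continuous_colSum j).measurable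

theorem measurable_v {d : ℕ} [NeZero d] : Measurable (v : G d → ℝ) := by
  have : (v : G d → ℝ) = fun g => ⨅ j, colSum g j := funext v_eq
  rw [this]
  exact Measurable.iInf fun j => (continuous_colSum j).measurable

theorem measurable_N {d : ℕ} [NeZero d] : Measurable (N : G d → ℝ) :=
  measurable_opNorm.max (measurable_const.div measurable_v)

theorem continuous_mulVec {d : ℕ} :
    Continuous fun q : G d × SPlus d => q.1.1 *ᵥ q.2.1 :=
  Continuous.matrix_mulVec (continuous_subtype_val.comp continuous_fst)
    (continuous_subtype_val.comp continuous_snd)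

theorem continuous_l1Norm {d : ℕ} : Continuous (l1Norm : (Fin d → ℝ) → ℝ) :=
  continuous_finsetSum _ fun i _ => (continuous_apply i).abs

theorem continuous_cocycle {d : ℕ} :
    Continuous fun q : G d × SPlus d => cocycle q.1 q.2 :=
  (continuous_l1Norm.comp continuous_mulVec).log fun q => (l1Norm_mulVec_pos q.1 q.2).ne'

theorem continuous_act {d : ℕ} : Continuous fun q : G d × SPlus d => act q.1 q.2 :=
  (((continuous_l1Norm.comp continuous_mulVec).inv₀ fun q =>
    (l1Norm_mulVec_pos q.1 q.2).ne').smul continuous_mulVec).subtype_mk _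

theorem measurable_cocycle {d : ℕ} :
    Measurable fun q : G d × SPlus d => cocycle q.1 q.2 := continuous_cocycle.measurable

theorem measurable_act {d : ℕ} :
    Measurable fun q : G d × SPlus d => act q.1 q.2 := continuous_act.measurable

theorem measurable_act_comp {d : ℕ} {α : Type*} [MeasurableSpace α] {f : α → G d}
    {x : α → SPlus d} (hf : Measurable f) (hx : Measurable x) :
    Measurable fun a => act (f a) (x a) := by
  have h := measurable_act.comp (hf.prodMk hx)
  exact h

theorem continuous_act_left {d : ℕ} (x : SPlus d) : Continuous fun g : G d => act g x := by
  have h := continuous_act.comp (continuous_id.prodMk (continuous_const (y := x)))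
  exact h

theorem continuous_act_right {d : ℕ} (g : G d) : Continuous fun x : SPlus d => act g x := by
  have h := continuous_act.comp ((continuous_const (y := g)).prodMk continuous_id)
  exact h

instance {d : ℕ} : MeasurableMul₂ (G d) := ⟨continuous_mul.measurable⟩

theorem isClosed_SPlus {d : ℕ} : IsClosed (SPlus d) := by
  have : SPlus d = l1Norm ⁻¹' {1} ∩ ⋂ i, {x | 0 ≤ x i} := by
    ext x
    simp [SPlus]
  rw [this]
  exact (isClosed_singleton.preimage continuous_l1Norm).inter
    (isClosed_iInter fun i => isClosed_le continuous_const (continuous_apply i))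

instance {d : ℕ} : CompleteSpace (SPlus d) := isClosed_SPlus.completeSpace_coe

/-! ### The spectral radius -/

attribute [local instance] Matrix.linftyOpNormedRing Matrix.linftyOpNormedAlgebra

/-- The transposed matrix with complex entries. -/
def complexTranspose {d : ℕ} (g : G d) : Matrix (Fin d) (Fin d) ℂ := (g.1.map Complex.ofReal)ᵀ

theorem complexTranspose_pow {d : ℕ} (g : G d) (n : ℕ) :
    complexTranspose g ^ n = complexTranspose (g ^ n) := by
  rw [complexTranspose, complexTranspose, ← Matrix.transpose_pow, SubmonoidClass.coe_pow]
  congr 1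
  exact (map_pow (Complex.ofRealHom.mapMatrix (m := Fin d)) g.1 n).symm

/-- The `ℓ∞` operator norm is the largest row sum of moduli; transposition turns it into the largest
column sum. -/
theorem norm_complexTranspose {d : ℕ} [NeZero d] (g : G d) : ‖complexTranspose g‖ = opNorm g := by
  have h : ∀ j, ∑ i, ‖complexTranspose g j i‖₊ = (colSum g j).toNNReal := by
    intro j
    rw [colSum, Real.toNNReal_sum_of_nonneg fun i _ => G_nonneg g i j]
    refine Finset.sum_congr rfl fun i _ => ?_
    rw [← norm_toNNReal]
    simp [complexTranspose, abs_of_nonneg (G_nonneg g i j)]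
  rw [Matrix.linfty_opNorm_def]
  simp only [h]
  refine le_antisymm ?_ ?_
  · obtain ⟨j, -, hj⟩ := Finset.exists_mem_eq_sup (Finset.univ : Finset (Fin d))
      Finset.univ_nonempty fun j => (colSum g j).toNNReal
    rw [hj, Real.coe_toNNReal _ (colSum_pos g j).le]
    exact colSum_le_opNorm g j
  · obtain ⟨j, hj⟩ := exists_colSum_eq_opNorm g
    rw [← hj, ← Real.coe_toNNReal _ (colSum_pos g j).le, NNReal.coe_le_coe]
    exact Finset.le_sup (f := fun j => (colSum g j).toNNReal) (Finset.mem_univ j)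

theorem spectralRadius_complexTranspose {d : ℕ} (g : G d) :
    spectralRadius ℂ (complexTranspose g) = spectralRadius ℂ (g.1.map Complex.ofReal) := by
  have : spectrum ℂ (complexTranspose g) = spectrum ℂ (g.1.map Complex.ofReal) := by
    ext z
    rw [spectrum.mem_iff, spectrum.mem_iff, not_iff_not, complexTranspose,
      ← Matrix.isUnit_transpose (A := _ - g.1.map Complex.ofReal), Matrix.transpose_sub,
      Matrix.algebraMap_eq_diagonal, Matrix.diagonal_transpose]
  rw [spectralRadius, spectralRadius, this]

/-- Gelfand's formula. The bounds on `kappa` and its measurability are all read off from this limit.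
-/
theorem tendsto_opNorm_pow_kappa {d : ℕ} [NeZero d] (g : G d) :
    Tendsto (fun n : ℕ => opNorm (g ^ n) ^ (1 / n : ℝ)) atTop (𝓝 (kappa g)) := by
  have h := spectrum.pow_norm_pow_one_div_tendsto_nhds_spectralRadius (complexTranspose g)
  have hfin : spectralRadius ℂ (complexTranspose g) ≠ ∞ :=
    ((spectrum.spectralRadius_le_nnnorm (𝕜 := ℂ) (complexTranspose g)).trans_lt
      ENNReal.coe_lt_top).ne
  have h2 := (ENNReal.tendsto_toReal hfin).comp h
  rw [spectralRadius_complexTranspose] at h2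
  refine h2.congr fun n => ?_
  rw [Function.comp_apply, ENNReal.toReal_ofReal (by positivity), complexTranspose_pow,
    norm_complexTranspose]

theorem opNorm_pow_le {d : ℕ} [NeZero d] (g : G d) (n : ℕ) : opNorm (g ^ n) ≤ opNorm g ^ n := by
  induction n with
  | zero => simp [opNorm_one]
  | succ n ih =>
    rw [pow_succ, pow_succ]
    exact (opNorm_mul_le _ _).trans (mul_le_mul_of_nonneg_right ih (opNorm_pos g).le)

theorem pow_v_le {d : ℕ} [NeZero d] (g : G d) (n : ℕ) : v g ^ n ≤ v (g ^ n) := by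
  induction n with
  | zero => simp [v_one]
  | succ n ih =>
    rw [pow_succ, pow_succ]
    exact (mul_le_mul_of_nonneg_right ih (v_pos g).le).trans (mul_v_le _ _)

theorem kappa_le_opNorm {d : ℕ} [NeZero d] (g : G d) : kappa g ≤ opNorm g := by
  refine le_of_tendsto (tendsto_opNorm_pow_kappa g) ?_
  filter_upwards [eventually_ge_atTop 1] with n hn
  calc opNorm (g ^ n) ^ (1 / n : ℝ) ≤ (opNorm g ^ n) ^ (1 / n : ℝ) :=
        Real.rpow_le_rpow (opNorm_pos _).le (opNorm_pow_le g n) (by positivity)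
    _ = opNorm g := by
        rw [one_div, Real.pow_rpow_inv_natCast (opNorm_pos g).le (by omega)]

theorem v_le_kappa {d : ℕ} [NeZero d] (g : G d) : v g ≤ kappa g := by
  refine ge_of_tendsto (tendsto_opNorm_pow_kappa g) ?_
  filter_upwards [eventually_ge_atTop 1] with n hn
  calc v g = (v g ^ n) ^ (1 / n : ℝ) := by
        rw [one_div, Real.pow_rpow_inv_natCast (v_pos g).le (by omega)]
    _ ≤ opNorm (g ^ n) ^ (1 / n : ℝ) :=
        Real.rpow_le_rpow (pow_nonneg (v_pos g).le _) ((pow_v_le g n).trans (v_le_opNorm _))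
          (by positivity)

theorem measurable_kappa {d : ℕ} [NeZero d] : Measurable (kappa : G d → ℝ) :=
  measurable_of_tendsto_metrizable
    (f := fun (n : ℕ) (g : G d) => opNorm (g ^ n) ^ (1 / n : ℝ))
    (fun n => (measurable_opNorm.comp (continuous_pow n).measurable).pow_const _)
    (tendsto_pi_nhds.2 tendsto_opNorm_pow_kappa)

theorem log_v_le_log_kappa {d : ℕ} [NeZero d] (g : G d) :
    Real.log (v g) ≤ Real.log (kappa g) := Real.log_le_log (v_pos g) (v_le_kappa g)

theorem log_kappa_le_log_opNorm {d : ℕ} [NeZero d] (g : G d) :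
    Real.log (kappa g) ≤ Real.log (opNorm g) :=
  Real.log_le_log ((v_pos g).trans_le (v_le_kappa g)) (kappa_le_opNorm g)

/-! ### Products of independent random matrices -/

/-- `Y` is a sequence of independent random matrices with law `μ`. -/
structure IsIIDSeq {d : ℕ} {Ω : Type*} [MeasurableSpace Ω] (Y : ℕ → Ω → G d) (μ : Measure (G d))
    (P : Measure Ω) : Prop where
  meas : ∀ n, Measurable (Y n)
  indep : iIndepFun Y P
  law : ∀ n, P.map (Y n) = μ

/-- The right products `Y_0 ⋯ Y_{n-1}`. -/
def rightProd {d : ℕ} {Ω : Type*} (Y : ℕ → Ω → G d) : ℕ → Ω → G d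
  | 0, _ => 1
  | n + 1, ω => rightProd Y n ω * Y n ω

instance {d : ℕ} (μ : Measure (G d)) [IsProbabilityMeasure μ] (n : ℕ) :
    IsProbabilityMeasure (convPow μ n) := by
  induction n with
  | zero => exact inferInstanceAs (IsProbabilityMeasure (Measure.dirac 1))
  | succ n ih => exact inferInstanceAs (IsProbabilityMeasure ((convPow μ n).mconv μ))

theorem convPow_add {d : ℕ} (μ : Measure (G d)) [IsProbabilityMeasure μ] (m n : ℕ) :
    convPow μ (m + n) = (convPow μ m).mconv (convPow μ n) := by
  induction n with
  | zero => exact (Measure.mconv_dirac_one _).symm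
  | succ n ih =>
    change (convPow μ (m + n)).mconv μ = (convPow μ m).mconv ((convPow μ n).mconv μ)
    rw [ih, Measure.mconv_assoc]

theorem convPow_one {d : ℕ} (μ : Measure (G d)) [IsProbabilityMeasure μ] : convPow μ 1 = μ :=
  Measure.dirac_one_mconv μ

theorem convPow_succ' {d : ℕ} (μ : Measure (G d)) [IsProbabilityMeasure μ] (n : ℕ) :
    convPow μ (n + 1) = μ.mconv (convPow μ n) := by
  rw [add_comm, convPow_add, convPow_one]

theorem measurable_leftProd {d : ℕ} {Ω : Type*} {m : MeasurableSpace Ω} {Y : ℕ → Ω → G d} {n : ℕ}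
    (hY : ∀ k < n, Measurable (Y k)) : Measurable (leftProd Y n) := by
  induction n with
  | zero => exact measurable_const
  | succ n ih => exact (hY n n.lt_succ_self).mul (ih fun k hk => hY k (hk.trans n.lt_succ_self))

theorem measurable_rightProd {d : ℕ} {Ω : Type*} {m : MeasurableSpace Ω} {Y : ℕ → Ω → G d} {n : ℕ}
    (hY : ∀ k < n, Measurable (Y k)) : Measurable (rightProd Y n) := by
  induction n with
  | zero => exact measurable_const
  | succ n ih => exact (ih fun k hk => hY k (hk.trans n.lt_succ_self)).mul (hY n n.lt_succ_self)

theorem IsIIDSeq.shift {d : ℕ} {Ω : Type*} [MeasurableSpace Ω] {Y : ℕ → Ω → G d}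
    {μ : Measure (G d)} {P : Measure Ω} (h : IsIIDSeq Y μ P) (a : ℕ) :
    IsIIDSeq (fun k => Y (a + k)) μ P :=
  ⟨fun _ => h.meas _, h.indep.precomp (add_right_injective a), fun _ => h.law _⟩

/-- The σ-algebra generated by the `Y k` with `k ∈ S`. -/
abbrev sigmaOf {d : ℕ} {Ω : Type*} (Y : ℕ → Ω → G d) (S : Set ℕ) : MeasurableSpace Ω :=
  ⨆ k ∈ S, MeasurableSpace.comap (Y k) inferInstance

theorem measurable_sigmaOf {d : ℕ} {Ω : Type*} (Y : ℕ → Ω → G d) {S : Set ℕ} {k : ℕ}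
    (hk : k ∈ S) : Measurable[sigmaOf Y S] (Y k) :=
  (comap_measurable (Y k)).mono
    (le_iSup₂ (f := fun k (_ : k ∈ S) => MeasurableSpace.comap (Y k) inferInstance) k hk) le_rfl

/-- Products of factors with indices in disjoint sets are independent; every later independence
claim about products reduces to this. -/
theorem IsIIDSeq.indepFun {d : ℕ} {Ω : Type*} [MeasurableSpace Ω] {Y : ℕ → Ω → G d}
    {μ : Measure (G d)} {P : Measure Ω} (h : IsIIDSeq Y μ P) {S T : Set ℕ} (hST : Disjoint S T)
    {β γ : Type*} [MeasurableSpace β] [MeasurableSpace γ] {U : Ω → β} {V : Ω → γ}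
    (hU : Measurable[sigmaOf Y S] U) (hV : Measurable[sigmaOf Y T] V) : IndepFun U V P := by
  have hi : Indep (sigmaOf Y S) (sigmaOf Y T) P :=
    indep_iSup_of_disjoint (fun k => (h.meas k).comap_le) h.indep.iIndep hST
  exact (IndepFun_iff_Indep _ _ _).2
    (indep_of_indep_of_le_left (indep_of_indep_of_le_right hi hV.comap_le) hU.comap_le)

theorem IsIIDSeq.measurable_leftProd {d : ℕ} {Ω : Type*} [MeasurableSpace Ω] {Y : ℕ → Ω → G d}
    {μ : Measure (G d)} {P : Measure Ω} (h : IsIIDSeq Y μ P) (n : ℕ) :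
    Measurable (leftProd Y n) := PosMat.measurable_leftProd fun k _ => h.meas k

theorem IsIIDSeq.measurable_rightProd {d : ℕ} {Ω : Type*} [MeasurableSpace Ω] {Y : ℕ → Ω → G d}
    {μ : Measure (G d)} {P : Measure Ω} (h : IsIIDSeq Y μ P) (n : ℕ) :
    Measurable (rightProd Y n) := PosMat.measurable_rightProd fun k _ => h.meas k

theorem IsIIDSeq.indepFun_leftProd {d : ℕ} {Ω : Type*} [MeasurableSpace Ω] {Y : ℕ → Ω → G d}
    {μ : Measure (G d)} {P : Measure Ω} (h : IsIIDSeq Y μ P) (n : ℕ) :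
    IndepFun (Y n) (leftProd Y n) P :=
  h.indepFun (S := {n}) (T := Set.Iio n) (by simp)
    (measurable_sigmaOf Y (Set.mem_singleton n))
    (PosMat.measurable_leftProd fun _ hk => measurable_sigmaOf Y hk)

theorem IsIIDSeq.indepFun_rightProd {d : ℕ} {Ω : Type*} [MeasurableSpace Ω] {Y : ℕ → Ω → G d}
    {μ : Measure (G d)} {P : Measure Ω} (h : IsIIDSeq Y μ P) (n : ℕ) :
    IndepFun (rightProd Y n) (Y n) P :=
  h.indepFun (S := Set.Iio n) (T := {n}) (by simp)
    (PosMat.measurable_rightProd fun _ hk => measurable_sigmaOf Y hk)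
    (measurable_sigmaOf Y (Set.mem_singleton n))

theorem IsIIDSeq.map_leftProd {d : ℕ} {Ω : Type*} [MeasurableSpace Ω] {Y : ℕ → Ω → G d}
    {μ : Measure (G d)} [IsProbabilityMeasure μ] {P : Measure Ω} [IsProbabilityMeasure P]
    (h : IsIIDSeq Y μ P) (n : ℕ) : P.map (leftProd Y n) = convPow μ n := by
  induction n with
  | zero =>
    have : leftProd Y 0 = fun _ => 1 := rfl
    rw [this, Measure.map_const, measure_univ, one_smul]
    rfl
  | succ n ih =>
    have : leftProd Y (n + 1) = Y n * leftProd Y n := rfl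
    rw [this, (h.indepFun_leftProd n).map_mul_eq_map_mconv_map (h.meas n)
      (h.measurable_leftProd n), h.law, ih, convPow_succ']

/-- For fixed `n`, reversing the order of i.i.d. factors does not change the law. Hence laws of left
products can be studied through right products, whose action converges pathwise. -/
theorem IsIIDSeq.map_rightProd {d : ℕ} {Ω : Type*} [MeasurableSpace Ω] {Y : ℕ → Ω → G d}
    {μ : Measure (G d)} [IsProbabilityMeasure μ] {P : Measure Ω} [IsProbabilityMeasure P]
    (h : IsIIDSeq Y μ P) (n : ℕ) : P.map (rightProd Y n) = convPow μ n := by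
  induction n with
  | zero =>
    have : rightProd Y 0 = fun _ => 1 := rfl
    rw [this, Measure.map_const, measure_univ, one_smul]
    rfl
  | succ n ih =>
    have : rightProd Y (n + 1) = rightProd Y n * Y n := rfl
    rw [this, (h.indepFun_rightProd n).map_mul_eq_map_mconv_map
      (h.measurable_rightProd n) (h.meas n), h.law, ih]
    rfl

theorem leftProd_add {d : ℕ} {Ω : Type*} (Y : ℕ → Ω → G d) (m n : ℕ) (ω : Ω) :
    leftProd Y (m + n) ω = leftProd (fun k => Y (m + k)) n ω * leftProd Y m ω := by
  induction n with
  | zero => exact (one_mul _).symm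
  | succ n ih =>
    change Y (m + n) ω * leftProd Y (m + n) ω = Y (m + n) ω * _ * _
    rw [ih, mul_assoc]

theorem rightProd_add {d : ℕ} {Ω : Type*} (Y : ℕ → Ω → G d) (m n : ℕ) (ω : Ω) :
    rightProd Y (m + n) ω = rightProd Y m ω * rightProd (fun k => Y (m + k)) n ω := by
  induction n with
  | zero => exact (mul_one _).symm
  | succ n ih =>
    change rightProd Y (m + n) ω * Y (m + n) ω = _ * (_ * Y (m + n) ω)
    rw [ih, mul_assoc]

/-! ### Products with positive entries -/

theorem mul_mem_GPlus_of_right {d : ℕ} (g : G d) {h : G d} (hh : h ∈ GPlus d) :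
    g * h ∈ GPlus d := by
  intro i j
  rw [Submonoid.coe_mul, Matrix.mul_apply]
  obtain ⟨k, hk⟩ := IsAllowable.row g.2 i
  exact Finset.sum_pos' (fun l _ => mul_nonneg (G_nonneg g i l) (G_nonneg h l j))
    ⟨k, Finset.mem_univ k, mul_pos hk (hh k j)⟩

theorem mul_mem_GPlus_of_left {d : ℕ} {g : G d} (h : G d) (hg : g ∈ GPlus d) :
    g * h ∈ GPlus d := by
  intro i j
  rw [Submonoid.coe_mul, Matrix.mul_apply]
  obtain ⟨k, hk⟩ := IsAllowable.col h.2 j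
  exact Finset.sum_pos' (fun l _ => mul_nonneg (G_nonneg g i l) (G_nonneg h l j))
    ⟨k, Finset.mem_univ k, mul_pos (hg i k) hk⟩

theorem measurableSet_GPlus (d : ℕ) : MeasurableSet (GPlus d) := by
  have : GPlus d = ⋂ i, ⋂ j, {g : G d | 0 < g.1 i j} := by
    ext g
    simp [GPlus]
  rw [this]
  exact MeasurableSet.iInter fun i => MeasurableSet.iInter fun j =>
    measurableSet_lt measurable_const (continuous_entry i j).measurable

/-- One positive factor makes a product of allowable matrices positive, so the product fails to be
positive only if both factors do. -/
theorem convPow_compl_GPlus_le {d : ℕ} (μ : Measure (G d)) [IsProbabilityMeasure μ] (m n : ℕ) :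
    convPow μ (m + n) (GPlus d)ᶜ ≤ convPow μ m (GPlus d)ᶜ * convPow μ n (GPlus d)ᶜ := by
  rw [convPow_add, Measure.mconv, Measure.map_apply measurable_mul (measurableSet_GPlus d).compl,
    ← Measure.prod_prod]
  refine measure_mono fun q hq => ⟨fun h => hq (mul_mem_GPlus_of_left _ h),
    fun h => hq (mul_mem_GPlus_of_right _ h)⟩

theorem convPow_mul_compl_GPlus_le {d : ℕ} (μ : Measure (G d)) [IsProbabilityMeasure μ]
    (r k : ℕ) : convPow μ (k * r) (GPlus d)ᶜ ≤ (convPow μ r (GPlus d)ᶜ) ^ k := by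
  induction k with
  | zero => simpa using prob_le_one
  | succ k ih =>
    rw [add_mul, one_mul, pow_succ]
    exact (convPow_compl_GPlus_le μ _ _).trans (mul_le_mul_left ih _)

theorem IsIIDSeq.ae_exists_leftProd_mem_GPlus {d : ℕ} {Ω : Type*} [MeasurableSpace Ω]
    {Y : ℕ → Ω → G d} {μ : Measure (G d)} [IsProbabilityMeasure μ] {P : Measure Ω}
    [IsProbabilityMeasure P] (h : IsIIDSeq Y μ P) (hμ : StrictlyContracting μ) :
    ∀ᵐ ω ∂P, ∃ n, leftProd Y n ω ∈ GPlus d := by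
  obtain ⟨r, -, hr⟩ := hμ
  have hlt : convPow μ r (GPlus d)ᶜ < 1 := by
    rw [prob_compl_eq_one_sub (measurableSet_GPlus d)]
    exact ENNReal.sub_lt_self ENNReal.one_ne_top one_ne_zero hr.ne'
  have hle : ∀ k : ℕ, P {ω | ¬ ∃ n, leftProd Y n ω ∈ GPlus d} ≤
      (convPow μ r (GPlus d)ᶜ) ^ k := by
    intro k
    refine le_trans ?_ (convPow_mul_compl_GPlus_le μ r k)
    rw [← h.map_leftProd, Measure.map_apply (h.measurable_leftProd _)
      (measurableSet_GPlus d).compl]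
    exact measure_mono fun ω hω hn => hω ⟨_, hn⟩
  exact le_antisymm (ge_of_tendsto' (ENNReal.tendsto_pow_atTop_nhds_zero_of_lt_one hlt) hle)
    bot_le

/-- Each column sum of `g * h` combines the entries of a column of `h` with the same positive
coefficients `colSum g i`. Passing from one column to another therefore costs at most the largest
ratio of two entries in a row of `h`, whatever `g` is. -/
theorem exists_log_opNorm_mul_sub_le {d : ℕ} [NeZero d] {h : G d} (hh : h ∈ GPlus d) :
    ∃ C : ℝ, ∀ g : G d, Real.log (opNorm (g * h)) - Real.log (v (g * h)) ≤ C := by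
  obtain ⟨c, hc⟩ := (Set.finite_range fun p : Fin d × Fin d × Fin d =>
    h.1 p.1 p.2.1 / h.1 p.1 p.2.2).bddAbove
  have hc' : ∀ i j k, h.1 i j ≤ c * h.1 i k := fun i j k =>
    (div_le_iff₀ (hh i k)).1 (hc ⟨(i, j, k), rfl⟩)
  refine ⟨Real.log c, fun g => ?_⟩
  obtain ⟨j, hj⟩ := exists_colSum_eq_opNorm (g * h)
  obtain ⟨k, hk⟩ := exists_colSum_eq_v (g * h)
  have hle : opNorm (g * h) ≤ c * v (g * h) := by
    rw [← hj, ← hk, colSum_mul, colSum_mul, Finset.mul_sum]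
    refine Finset.sum_le_sum fun i _ => ?_
    calc colSum g i * h.1 i j ≤ colSum g i * (c * h.1 i k) :=
          mul_le_mul_of_nonneg_left (hc' i j k) (colSum_pos g i).le
      _ = c * (colSum g i * h.1 i k) := by ring
  have hc0 : 0 < c :=
    (pos_iff_pos_of_mul_pos ((opNorm_pos _).trans_le hle)).2 (v_pos _)
  have := Real.log_le_log (opNorm_pos _) hle
  rw [Real.log_mul hc0.ne' (v_pos _).ne'] at this
  linarith

theorem IsIIDSeq.ae_tendsto_log_ratio {d : ℕ} [NeZero d] {Ω : Type*} [MeasurableSpace Ω]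
    {Y : ℕ → Ω → G d} {μ : Measure (G d)} [IsProbabilityMeasure μ] {P : Measure Ω}
    [IsProbabilityMeasure P] (h : IsIIDSeq Y μ P) (hμ : StrictlyContracting μ) :
    ∀ᵐ ω ∂P, Tendsto (fun n : ℕ =>
      (Real.log (opNorm (leftProd Y n ω)) - Real.log (v (leftProd Y n ω))) / n) atTop (𝓝 0) := by
  filter_upwards [h.ae_exists_leftProd_mem_GPlus hμ] with ω ⟨m, hm⟩
  obtain ⟨C, hC⟩ := exists_log_opNorm_mul_sub_le hm
  refine tendsto_of_tendsto_of_tendsto_of_le_of_le' tendsto_const_nhds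
    (tendsto_const_div_atTop_nhds_zero_nat C) (Eventually.of_forall fun n => ?_) ?_
  · exact div_nonneg (sub_nonneg.2 (log_v_le_log_opNorm _)) n.cast_nonneg
  · filter_upwards [eventually_ge_atTop m] with n hn
    -- Every later product has the positive matrix `leftProd Y m ω` as right factor, so one `C`
    -- works for all `n ≥ m`.
    obtain ⟨k, rfl⟩ := Nat.exists_eq_add_of_le hn
    rw [leftProd_add]
    exact div_le_div_of_nonneg_right (hC _) (Nat.cast_nonneg _)

/-! ### Oscillation of the normalized columns -/

/-- The oscillation of a finite family of reals. -/
def osc {d : ℕ} (u : Fin d → ℝ) : ℝ := (⨆ k, u k) - ⨅ k, u k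

theorem le_iSup_fin {d : ℕ} (u : Fin d → ℝ) (k : Fin d) : u k ≤ ⨆ k, u k :=
  le_ciSup (Set.finite_range u).bddAbove k

theorem iInf_fin_le {d : ℕ} (u : Fin d → ℝ) (k : Fin d) : ⨅ k, u k ≤ u k :=
  ciInf_le (Set.finite_range u).bddBelow k

theorem osc_nonneg {d : ℕ} [NeZero d] (u : Fin d → ℝ) : 0 ≤ osc u :=
  sub_nonneg.2 ((iInf_fin_le u 0).trans (le_iSup_fin u 0))

theorem iInf_le_sum_mul {d : ℕ} {w : Fin d → ℝ} (hw : ∀ k, 0 ≤ w k) (hw1 : ∑ k, w k = 1)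
    (u : Fin d → ℝ) : ⨅ k, u k ≤ ∑ k, w k * u k := by
  calc ⨅ k, u k = ∑ k, w k * ⨅ k, u k := by rw [← Finset.sum_mul, hw1, one_mul]
    _ ≤ ∑ k, w k * u k :=
        Finset.sum_le_sum fun k _ => mul_le_mul_of_nonneg_left (iInf_fin_le u k) (hw k)

/-- The index where `u` is smallest carries weight at least `δ`, which pulls the mean down from the
supremum by `δ * osc u`. -/
theorem sum_mul_le_sub {d : ℕ} [NeZero d] {w : Fin d → ℝ} {δ : ℝ} (hδ : 0 ≤ δ)
    (hw : ∀ k, δ ≤ w k) (hw1 : ∑ k, w k = 1) (u : Fin d → ℝ) :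
    ∑ k, w k * u k ≤ (⨆ k, u k) - δ * osc u := by
  obtain ⟨k₀, hk₀⟩ := exists_eq_ciInf_of_finite (f := u)
  have h : δ * osc u ≤ ∑ k, w k * ((⨆ k, u k) - u k) := by
    calc δ * osc u ≤ w k₀ * ((⨆ k, u k) - u k₀) := by
          rw [hk₀]
          exact mul_le_mul_of_nonneg_right (hw k₀) (osc_nonneg u)
      _ ≤ ∑ k, w k * ((⨆ k, u k) - u k) :=
          Finset.single_le_sum (f := fun k => w k * ((⨆ k, u k) - u k))
            (fun k _ => mul_nonneg (hδ.trans (hw k)) (sub_nonneg.2 (le_iSup_fin u k)))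
            (Finset.mem_univ k₀)
  simp only [mul_sub, Finset.sum_sub_distrib, ← Finset.sum_mul, hw1, one_mul] at h
  linarith

theorem osc_sum_mul_le {d : ℕ} [NeZero d] {W : Fin d → Fin d → ℝ} {δ : ℝ} (hδ : 0 ≤ δ)
    (hW : ∀ k j, δ ≤ W k j) (hW1 : ∀ j, ∑ k, W k j = 1) (u : Fin d → ℝ) :
    osc (fun j => ∑ k, W k j * u k) ≤ (1 - δ) * osc u := by
  have h1 : (⨆ j, ∑ k, W k j * u k) ≤ (⨆ k, u k) - δ * osc u :=
    ciSup_le fun j => sum_mul_le_sub hδ (fun k => hW k j) (hW1 j) u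
  have h2 : ⨅ k, u k ≤ ⨅ j, ∑ k, W k j * u k :=
    le_ciInf fun j => iInf_le_sum_mul (fun k => hδ.trans (hW k j)) (hW1 j) u
  have h3 : osc u = (⨆ k, u k) - ⨅ k, u k := rfl
  rw [osc, sub_mul, one_mul]
  linarith

/-- The matrix with columns normalized in `ℓ¹`. -/
def normCol {d : ℕ} (g : G d) (i k : Fin d) : ℝ := g.1 i k / colSum g k

/-- The sum over the rows of the oscillations of the normalized columns. It controls the diameter
of the image of `S⁺`. -/
def colOsc {d : ℕ} (g : G d) : ℝ := ∑ i, osc (normCol g i)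

theorem colOsc_nonneg {d : ℕ} [NeZero d] (g : G d) : 0 ≤ colOsc g :=
  Finset.sum_nonneg fun _ _ => osc_nonneg _

theorem colOsc_le {d : ℕ} [NeZero d] (g : G d) : colOsc g ≤ d := by
  have h : ∀ i, osc (normCol g i) ≤ 1 := by
    intro i
    have h1 : (⨆ k, normCol g i k) ≤ 1 := ciSup_le fun k =>
      (div_le_one (colSum_pos g k)).2
        (Finset.single_le_sum (fun i _ => G_nonneg g i k) (Finset.mem_univ i))
    have h2 : 0 ≤ ⨅ k, normCol g i k := le_ciInf fun k =>
      div_nonneg (G_nonneg g i k) (colSum_pos g k).le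
    rw [osc]
    linarith
  exact (Finset.sum_le_sum fun i _ => h i).trans (by simp)

theorem measurable_colOsc {d : ℕ} [NeZero d] : Measurable (colOsc : G d → ℝ) := by
  have hm : ∀ i k, Measurable fun g : G d => normCol g i k := fun i k =>
    (continuous_entry i k).measurable.div (continuous_colSum k).measurable
  exact Finset.measurable_fun_sum _ fun i _ =>
    (Measurable.iSup fun k => hm i k).sub (Measurable.iInf fun k => hm i k)

/-- The normalized columns of `g * h` are convex combinations of those of `g`. So right
multiplication never increases `colOsc`, and decreases it strictly when the weights are bounded
below and `colOsc g` is not zero. -/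
theorem normCol_mul {d : ℕ} (g h : G d) (i j : Fin d) :
    normCol (g * h) i j =
      ∑ k, colSum g k * h.1 k j / colSum (g * h) j * normCol g i k := by
  rw [normCol, Submonoid.coe_mul, Matrix.mul_apply, Finset.sum_div]
  refine Finset.sum_congr rfl fun k _ => ?_
  have := (colSum_pos g k).ne'
  rw [normCol]
  field_simp

theorem colOsc_mul_le_of_le {d : ℕ} [NeZero d] {g h : G d} {δ : ℝ} (hδ : 0 ≤ δ)
    (hle : ∀ k j, δ ≤ colSum g k * h.1 k j / colSum (g * h) j) :
    colOsc (g * h) ≤ (1 - δ) * colOsc g := by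
  rw [colOsc, colOsc, Finset.mul_sum]
  refine Finset.sum_le_sum fun i _ => ?_
  have heq : normCol (g * h) i =
      fun j => ∑ k, colSum g k * h.1 k j / colSum (g * h) j * normCol g i k :=
    funext (normCol_mul g h i)
  rw [heq]
  refine osc_sum_mul_le hδ hle (fun j => ?_) _
  rw [← Finset.sum_div, ← colSum_mul, div_self (colSum_pos _ j).ne']

theorem colOsc_mul_le {d : ℕ} [NeZero d] (g h : G d) : colOsc (g * h) ≤ colOsc g := by
  simpa using colOsc_mul_le_of_le (g := g) (h := h) le_rfl fun k j =>
    div_nonneg (mul_nonneg (colSum_pos g k).le (G_nonneg h k j)) (colSum_pos _ j).le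

theorem act_apply {d : ℕ} (g : G d) (x : SPlus d) (i : Fin d) :
    (act g x).1 i = ∑ k, colSum g k * x.1 k / l1Norm (g.1 *ᵥ x.1) * normCol g i k := by
  change (l1Norm (g.1 *ᵥ x.1))⁻¹ * ∑ k, g.1 i k * x.1 k = _
  rw [Finset.mul_sum]
  refine Finset.sum_congr rfl fun k _ => ?_
  have := (colSum_pos g k).ne'
  rw [normCol]
  field_simp

/-- Each `act g x` is a convex combination of the normalized columns of `g`, so two such points
differ in each coordinate by at most the oscillation of that row. -/
theorem dist_act_le {d : ℕ} [NeZero d] (g : G d) (x y : SPlus d) :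
    dist (act g x) (act g y) ≤ colOsc g := by
  have hw : ∀ x : SPlus d, ∀ k, 0 ≤ colSum g k * x.1 k / l1Norm (g.1 *ᵥ x.1) := fun x k =>
    div_nonneg (mul_nonneg (colSum_pos g k).le (x.2.2 k)) (l1Norm_mulVec_pos g x).le
  have hw1 : ∀ x : SPlus d, ∑ k, colSum g k * x.1 k / l1Norm (g.1 *ᵥ x.1) = 1 := fun x => by
    rw [← Finset.sum_div, ← l1Norm_mulVec_eq g x.2.2, div_self (l1Norm_mulVec_pos g x).ne']
  have hup : ∀ x : SPlus d, ∀ i, (act g x).1 i ≤ ⨆ k, normCol g i k := fun x i => by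
    rw [act_apply]
    simpa using sum_mul_le_sub le_rfl (hw x) (hw1 x) (normCol g i)
  have hlo : ∀ x : SPlus d, ∀ i, ⨅ k, normCol g i k ≤ (act g x).1 i := fun x i => by
    rw [act_apply]
    exact iInf_le_sum_mul (hw x) (hw1 x) (normCol g i)
  rw [Subtype.dist_eq, dist_pi_le_iff (colOsc_nonneg g)]
  intro i
  have hi : osc (normCol g i) ≤ colOsc g :=
    Finset.single_le_sum (f := fun i => osc (normCol g i)) (fun _ _ => osc_nonneg _)
      (Finset.mem_univ i)
  rw [osc] at hi
  rw [Real.dist_eq, abs_le]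
  constructor <;> linarith [hup x i, hup y i, hlo x i, hlo y i]

/-! ### Contraction in mean of the column oscillation -/

/-- The matrices with all entries between `M⁻¹` and `M`. -/
def boundedEntries (d : ℕ) (M : ℝ) : Set (G d) := {h | ∀ i j, M⁻¹ ≤ h.1 i j ∧ h.1 i j ≤ M}

theorem measurableSet_boundedEntries (d : ℕ) (M : ℝ) : MeasurableSet (boundedEntries d M) := by
  have : boundedEntries d M = ⋂ i, ⋂ j, {g : G d | M⁻¹ ≤ g.1 i j} ∩ {g : G d | g.1 i j ≤ M} := by
    ext g
    simp [boundedEntries]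
  rw [this]
  exact MeasurableSet.iInter fun i => MeasurableSet.iInter fun j =>
    (measurableSet_le measurable_const (continuous_entry i j).measurable).inter
      (measurableSet_le (continuous_entry i j).measurable measurable_const)

/-- The weights involve the column sums of the left factor, which for arbitrary `g` may be very
unbalanced. The factor `h₁` first brings them all between `M⁻¹ T` and `M T`, with `T` the total mass
of `g`; then `h₂` mixes with weights at least `M⁻¹ T M⁻¹ / (d M T M)`, whence the constant. -/
theorem colOsc_mul_mul_le {d : ℕ} [NeZero d] {M : ℝ} (hM : 0 < M) (g : G d) {h₁ h₂ : G d}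
    (H₁ : h₁ ∈ boundedEntries d M) (H₂ : h₂ ∈ boundedEntries d M) :
    colOsc (g * (h₁ * h₂)) ≤ (1 - (d * M ^ 4)⁻¹) * colOsc g := by
  have hd : (0 : ℝ) < d := by exact_mod_cast NeZero.pos d
  set δ : ℝ := (d * M ^ 4)⁻¹ with hδdef
  have hδ : 0 ≤ δ := by positivity
  set T : ℝ := ∑ l, colSum g l with hT
  have hT0 : 0 < T := Finset.sum_pos (fun l _ => colSum_pos g l) Finset.univ_nonempty
  have hlo : ∀ k, M⁻¹ * T ≤ colSum (g * h₁) k := fun k => by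
    rw [colSum_mul, hT, Finset.mul_sum]
    refine Finset.sum_le_sum fun l _ => ?_
    rw [mul_comm]
    exact mul_le_mul_of_nonneg_left (H₁ l k).1 (colSum_pos g l).le
  have hup : ∀ k, colSum (g * h₁) k ≤ M * T := fun k => by
    rw [colSum_mul, hT, Finset.mul_sum]
    refine Finset.sum_le_sum fun l _ => ?_
    rw [mul_comm M]
    exact mul_le_mul_of_nonneg_left (H₁ l k).2 (colSum_pos g l).le
  have hW : ∀ k j, δ ≤ colSum (g * h₁) k * h₂.1 k j / colSum (g * h₁ * h₂) j := by
    intro k j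
    have hden : colSum (g * h₁ * h₂) j ≤ d * (M * T * M) := by
      rw [colSum_mul]
      refine (Finset.sum_le_sum (g := fun _ => M * T * M) fun l _ => ?_).trans (by simp)
      exact mul_le_mul (hup l) (H₂ l j).2 (G_nonneg _ _ _) (by positivity)
    have hnum : M⁻¹ * T * M⁻¹ ≤ colSum (g * h₁) k * h₂.1 k j :=
      mul_le_mul (hlo k) (H₂ k j).1 (by positivity) (colSum_pos _ _).le
    calc δ = M⁻¹ * T * M⁻¹ / (d * (M * T * M)) := by
          rw [hδdef]
          field_simp
      _ ≤ _ := div_le_div₀ ((by positivity : (0 : ℝ) ≤ M⁻¹ * T * M⁻¹).trans hnum) hnum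
          (colSum_pos _ _) hden
  -- Monotonicity under multiplication by `1 - δ` needs its sign. It cannot be negative, since a
  -- family of weights each at least `δ` sums to `1`.
  rcases le_or_gt 0 (1 - δ) with h1 | h1
  · rw [← mul_assoc]
    exact (colOsc_mul_le_of_le hδ hW).trans (mul_le_mul_of_nonneg_left (colOsc_mul_le g h₁) h1)
  · exfalso
    have := Finset.sum_le_sum fun k (_ : k ∈ Finset.univ) => hW k 0
    rw [← Finset.sum_div, ← colSum_mul, div_self (colSum_pos _ _).ne'] at this
    have h2 : δ ≤ ∑ _k : Fin d, δ :=
      Finset.single_le_sum (f := fun _ : Fin d => δ) (fun _ _ => hδ) (Finset.mem_univ 0)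
    linarith

theorem exists_boundedEntries_pos {d : ℕ} {η : Measure (G d)} (hη : 0 < η (GPlus d)) :
    ∃ M : ℝ, 0 < M ∧ 0 < η (boundedEntries d M) := by
  have hsub : GPlus d ⊆ ⋃ n : ℕ, boundedEntries d ((n : ℝ) + 1) := by
    intro g hg
    obtain ⟨c, hc⟩ := (Set.finite_range fun p : Fin d × Fin d =>
      max (g.1 p.1 p.2) (g.1 p.1 p.2)⁻¹).bddAbove
    obtain ⟨n, hn⟩ := exists_nat_ge c
    refine Set.mem_iUnion.2 ⟨n, fun i j => ?_⟩
    have h := hc ⟨(i, j), rfl⟩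
    have h1 : g.1 i j ≤ (n : ℝ) + 1 := (le_max_left _ _).trans (h.trans (by linarith))
    have h2 : (g.1 i j)⁻¹ ≤ (n : ℝ) + 1 := (le_max_right _ _).trans (h.trans (by linarith))
    exact ⟨inv_le_of_inv_le₀ (hg i j) h2, h1⟩
  obtain ⟨n, hn⟩ := exists_measure_pos_of_not_measure_iUnion_null
    (fun h0 => hη.ne' (measure_mono_null hsub h0))
  exact ⟨n + 1, by positivity, hn⟩

/-- Of the `2 r` additional factors, the two halves both have entries in `[M⁻¹, M]` with positive
probability. On that event the oscillation shrinks by `1 - δ`, and otherwise it does not grow; `K`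
is the mean of this factor. -/
theorem exists_lintegral_colOsc_contraction {d : ℕ} [NeZero d] {μ : Measure (G d)}
    [IsProbabilityMeasure μ] (hμ : StrictlyContracting μ) :
    ∃ (q : ℕ) (K : ℝ≥0∞), K < 1 ∧ ∀ n,
      ∫⁻ g, ENNReal.ofReal (colOsc g) ∂(convPow μ (n + q)) ≤
        K * ∫⁻ g, ENNReal.ofReal (colOsc g) ∂(convPow μ n) := by
  classical
  obtain ⟨r, -, hr⟩ := hμ
  obtain ⟨M, hM, hpos⟩ := exists_boundedEntries_pos hr
  have hd : (0 : ℝ) < d := by exact_mod_cast NeZero.pos d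
  set δ : ℝ := (d * M ^ 4)⁻¹ with hδdef
  have hδ : 0 < δ := by positivity
  set B := boundedEntries d M ×ˢ boundedEntries d M with hB
  have hBm : MeasurableSet B :=
    (measurableSet_boundedEntries d M).prod (measurableSet_boundedEntries d M)
  set k : G d × G d → ℝ≥0∞ := fun z => if z ∈ B then ENNReal.ofReal (1 - δ) else 1 with hk
  have hkm : Measurable k := Measurable.ite hBm measurable_const measurable_const
  have hlt : ENNReal.ofReal (1 - δ) < 1 := by
    rw [← ENNReal.ofReal_one]
    exact (ENNReal.ofReal_lt_ofReal_iff one_pos).2 (by linarith)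
  have hk1 : ∀ z, k z ≤ 1 := fun z => by
    simp only [hk]
    split_ifs
    exacts [hlt.le, le_rfl]
  have hD : Measurable fun g : G d => ENNReal.ofReal (colOsc g) :=
    measurable_colOsc.ennreal_ofReal
  set ρ := (convPow μ r).prod (convPow μ r) with hρ
  refine ⟨r + r, ∫⁻ z, k z ∂ρ, ?_, fun n => ?_⟩
  · have h1 : ∫⁻ _, (1 : ℝ≥0∞) ∂ρ = 1 := by simp
    have hfin : ∫⁻ z, k z ∂ρ ≠ ∞ :=
      ((lintegral_mono hk1).trans_lt (h1.trans_lt ENNReal.one_lt_top)).ne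
    rw [← h1]
    refine lintegral_strict_mono_of_ae_le_of_ae_lt_on (s := B) aemeasurable_const hfin
      (Eventually.of_forall hk1) ?_ (Eventually.of_forall fun z hz => ?_)
    · rw [hρ, hB, Measure.prod_prod]
      exact (ENNReal.mul_pos hpos.ne' hpos.ne').ne'
    · simpa only [hk, if_pos hz] using hlt
  · rw [convPow_add μ n, Measure.lintegral_mconv hD, ← lintegral_const_mul _ hD]
    refine lintegral_mono fun g => ?_
    have hDg : Measurable fun h : G d => ENNReal.ofReal (colOsc (g * h)) :=
      hD.comp (measurable_const_mul g)
    rw [convPow_add μ r, Measure.lintegral_mconv_eq_lintegral_prod hDg,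
      ← lintegral_mul_const _ hkm]
    refine lintegral_mono fun z => ?_
    simp only [hk]
    split_ifs with hz
    · rw [← ENNReal.ofReal_mul' (colOsc_nonneg g)]
      exact ENNReal.ofReal_le_ofReal (colOsc_mul_mul_le hM g hz.1 hz.2)
    · rw [one_mul]
      exact ENNReal.ofReal_le_ofReal (colOsc_mul_le g _)

section

variable {d : ℕ} [NeZero d] {Ω : Type*} [MeasurableSpace Ω] {Y : ℕ → Ω → G d} {μ : Measure (G d)}
  [IsProbabilityMeasure μ] {P : Measure Ω} [IsProbabilityMeasure P]

theorem antitone_colOsc_rightProd (Y : ℕ → Ω → G d) (ω : Ω) :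
    Antitone fun n => colOsc (rightProd Y n ω) :=
  antitone_nat_of_succ_le fun _ => colOsc_mul_le _ _

theorem IsIIDSeq.ae_tendsto_colOsc (h : IsIIDSeq Y μ P) (hμ : StrictlyContracting μ) :
    ∀ᵐ ω ∂P, Tendsto (fun n => colOsc (rightProd Y n ω)) atTop (𝓝 0) := by
  obtain ⟨q, K, hK, hle⟩ := exists_lintegral_colOsc_contraction hμ
  have hD : Measurable fun g : G d => ENNReal.ofReal (colOsc g) :=
    measurable_colOsc.ennreal_ofReal
  have hmeas : ∀ n, Measurable fun ω => ENNReal.ofReal (colOsc (rightProd Y n ω)) := fun n =>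
    hD.comp (h.measurable_rightProd n)
  have hbound : ∀ k : ℕ, ∫⁻ g, ENNReal.ofReal (colOsc g) ∂(convPow μ (k * q)) ≤ K ^ k * d := by
    intro k
    induction k with
    | zero =>
      rw [pow_zero, one_mul]
      refine (lintegral_mono (g := fun _ => (d : ℝ≥0∞)) fun g => ?_).trans (by simp)
      rw [← ENNReal.ofReal_natCast]
      exact ENNReal.ofReal_le_ofReal (colOsc_le g)
    | succ k ih =>
      rw [add_mul, one_mul, pow_succ', mul_assoc]
      exact (hle _).trans (by gcongr)
  have hlim : Tendsto (fun k : ℕ => K ^ k * (d : ℝ≥0∞)) atTop (𝓝 0) := by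
    have := ENNReal.Tendsto.mul_const (ENNReal.tendsto_pow_atTop_nhds_zero_of_lt_one hK)
      (Or.inr (ENNReal.natCast_ne_top d))
    rwa [zero_mul] at this
  -- The means tend to zero along multiples of `q`, so the infimum vanishes almost surely;
  -- monotonicity makes this infimum the limit.
  have hzero : ∫⁻ ω, ⨅ n, ENNReal.ofReal (colOsc (rightProd Y n ω)) ∂P = 0 := by
    refine le_antisymm (ge_of_tendsto' hlim fun k => ?_) bot_le
    refine le_trans ?_ (hbound k)
    rw [← h.map_rightProd, lintegral_map hD (h.measurable_rightProd _)]
    exact lintegral_mono fun ω => iInf_le _ _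
  rw [lintegral_eq_zero_iff (Measurable.iInf hmeas)] at hzero
  filter_upwards [hzero] with ω hω
  have hanti : Antitone fun n => ENNReal.ofReal (colOsc (rightProd Y n ω)) := fun m n hmn =>
    ENNReal.ofReal_le_ofReal (antitone_colOsc_rightProd Y ω hmn)
  have h1 := tendsto_atTop_iInf hanti
  rw [hω] at h1
  have h2 := (ENNReal.tendsto_toReal ENNReal.zero_ne_top).comp h1
  refine h2.congr fun n => ?_
  exact ENNReal.toReal_ofReal (colOsc_nonneg _)

/-! ### The invariant measure -/

/-- A new factor of a right product acts first, so later points stay in the image of `S⁺` under the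
earlier product. The diameters of these nested images tend to zero, so the sequence is Cauchy and
its limit does not depend on `x`. -/
theorem IsIIDSeq.exists_limit (h : IsIIDSeq Y μ P) (hμ : StrictlyContracting μ) :
    ∃ Z : Ω → SPlus d, Measurable Z ∧
      ∀ᵐ ω ∂P, ∀ x, Tendsto (fun n => act (rightProd Y n ω) x) atTop (𝓝 (Z ω)) := by
  have hmeas : ∀ n, Measurable fun ω => act (rightProd Y n ω) (basisVec 0) := fun n =>
    measurable_act_comp (h.measurable_rightProd n) measurable_const
  have hconv : ∀ᵐ ω ∂P, ∃ l,
      Tendsto (fun n => act (rightProd Y n ω) (basisVec 0)) atTop (𝓝 l) := by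
    filter_upwards [h.ae_tendsto_colOsc hμ] with ω hω
    refine cauchySeq_tendsto_of_complete (cauchySeq_of_le_tendsto_0 _ (fun n m k hn hm => ?_) hω)
    obtain ⟨a, rfl⟩ := Nat.exists_eq_add_of_le hn
    obtain ⟨b, rfl⟩ := Nat.exists_eq_add_of_le hm
    rw [rightProd_add, rightProd_add, act_mul, act_mul]
    exact dist_act_le _ _ _
  obtain ⟨Z, hZ, hlim⟩ :=
    measurable_limit_of_tendsto_metrizable_ae (fun n => (hmeas n).aemeasurable) hconv
  refine ⟨Z, hZ, ?_⟩
  filter_upwards [hlim, h.ae_tendsto_colOsc hμ] with ω h1 h2 x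
  refine h1.congr_dist ?_
  exact squeeze_zero (fun _ => dist_nonneg) (fun n => dist_act_le _ _ _) h2

theorem IsIIDSeq.exists_tendsto_integral (h : IsIIDSeq Y μ P) (hμ : StrictlyContracting μ) :
    ∃ ν : Measure (SPlus d), IsProbabilityMeasure ν ∧ ∀ (f : SPlus d →ᵇ ℝ) (x : SPlus d),
      Tendsto (fun n => ∫ g, f (act g x) ∂(convPow μ n)) atTop (𝓝 (∫ y, f y ∂ν)) := by
  obtain ⟨Z, hZ, hlim⟩ := h.exists_limit hμ
  refine ⟨P.map Z, Measure.isProbabilityMeasure_map hZ.aemeasurable, fun f x => ?_⟩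
  have hact : Measurable fun g : G d => f (act g x) :=
    f.continuous.measurable.comp (continuous_act_left x).measurable
  rw [integral_map hZ.aemeasurable f.continuous.aestronglyMeasurable]
  have heq : ∀ n, ∫ g, f (act g x) ∂(convPow μ n) = ∫ ω, f (act (rightProd Y n ω) x) ∂P := by
    intro n
    rw [← h.map_rightProd, integral_map (h.measurable_rightProd n).aemeasurable
      hact.aestronglyMeasurable]
  simp only [heq]
  refine tendsto_integral_of_dominated_convergence (fun _ => ‖f‖)
    (fun n => (hact.comp (h.measurable_rightProd n)).aestronglyMeasurable)
    (integrable_const _) (fun n => Eventually.of_forall fun ω => f.norm_coe_le_norm _) ?_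
  filter_upwards [hlim] with ω hω
  exact (f.continuous.tendsto _).comp (hω x)

end

/-! ### Invariance, existence and uniqueness -/

theorem integral_prod_act {d : ℕ} (η : Measure (G d)) [IsProbabilityMeasure η]
    (ν : Measure (SPlus d)) [IsProbabilityMeasure ν] (f : SPlus d →ᵇ ℝ) :
    ∫ y, f y ∂((η.prod ν).map fun q : G d × SPlus d => act q.1 q.2) =
      ∫ g, ∫ x, f (act g x) ∂ν ∂η := by
  rw [integral_map measurable_act.aemeasurable f.continuous.aestronglyMeasurable, integral_prod]
  exact ((f.compContinuous ⟨_, continuous_act⟩).integrable (η.prod ν) :)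

theorem integral_mconv_of_bounded {d : ℕ} (η ρ : Measure (G d)) [IsProbabilityMeasure η]
    [IsProbabilityMeasure ρ] (F : G d →ᵇ ℝ) :
    ∫ g, F g ∂(η.mconv ρ) = ∫ g, ∫ h, F (g * h) ∂ρ ∂η := by
  rw [Measure.mconv, integral_map measurable_mul.aemeasurable F.continuous.aestronglyMeasurable,
    integral_prod]
  exact ((F.compContinuous ⟨_, continuous_mul⟩).integrable (η.prod ρ) :)

theorem isInvariantProb_iff {d : ℕ} {μ : Measure (G d)} {ν : Measure (SPlus d)} :
    IsInvariantProb μ ν ↔ IsProbabilityMeasure ν ∧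
      (μ.prod ν).map (fun q : G d × SPlus d => act q.1 q.2) = ν := by
  refine and_congr_right fun _ => ⟨fun h => Measure.ext_of_lintegral _ fun f hf => ?_,
    fun h f hf => ?_⟩
  · rw [lintegral_map hf measurable_act, h f hf]
  · conv_rhs => rw [← h]
    rw [lintegral_map hf measurable_act]

theorem IsInvariantProb.convPow {d : ℕ} {μ : Measure (G d)} [IsProbabilityMeasure μ]
    {ν : Measure (SPlus d)} (h : IsInvariantProb μ ν) (n : ℕ) :
    IsInvariantProb (PosMat.convPow μ n) ν := by
  have := h.1
  refine ⟨h.1, fun f hf => ?_⟩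
  have hfa : Measurable fun q : G d × SPlus d => f (act q.1 q.2) := hf.comp measurable_act
  induction n generalizing f with
  | zero =>
    rw [lintegral_prod _ hfa.aemeasurable]
    change ∫⁻ g, _ ∂(Measure.dirac 1) = _
    rw [lintegral_dirac' _ hfa.lintegral_prod_right']
    simp only [act_one]
  | succ n ih =>
    rw [lintegral_prod _ hfa.aemeasurable, convPow_succ',
      Measure.lintegral_mconv hfa.lintegral_prod_right', ← h.2 f hf,
      lintegral_prod _ hfa.aemeasurable]
    refine lintegral_congr fun g => ?_
    have hg : Measurable fun x : SPlus d => f (act g x) :=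
      hf.comp (continuous_act_right g).measurable
    have hga : Measurable fun q : G d × SPlus d => f (act g (act q.1 q.2)) := by
      have h := hg.comp measurable_act
      exact h
    rw [← ih _ hg hga, lintegral_prod _ hga.aemeasurable]
    simp only [act_mul]

theorem IsIIDSeq.exists_unique_isInvariantProb {d : ℕ} [NeZero d] {Ω : Type*} [MeasurableSpace Ω]
    {Y : ℕ → Ω → G d} {μ : Measure (G d)} [IsProbabilityMeasure μ] {P : Measure Ω}
    [IsProbabilityMeasure P] (h : IsIIDSeq Y μ P) (hμ : StrictlyContracting μ) :
    ∃ ν, IsInvariantProb μ ν ∧ ∀ ν', IsInvariantProb μ ν' → ν' = ν := by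
  obtain ⟨ν, hν, hlim⟩ := h.exists_tendsto_integral hμ
  have hactm : Measurable fun q : G d × SPlus d => act q.1 q.2 := measurable_act
  refine ⟨ν, isInvariantProb_iff.2 ⟨hν, ?_⟩, fun ν' hν' => ?_⟩
  · have := Measure.isProbabilityMeasure_map (μ := μ.prod ν) hactm.aemeasurable
    refine ext_of_forall_integral_eq_of_IsFiniteMeasure fun f => ?_
    rw [integral_prod_act]
    set x₀ : SPlus d := basisVec 0
    have hF : ∀ x, Continuous fun g : G d => act g x := continuous_act_left
    -- Invariance: one more step by `μ` after `n` steps from `x₀` is `n + 1` steps from `x₀`, so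
    -- both have the same limit.
    have h1 : Tendsto (fun n => ∫ g, ∫ k, f (act g (act k x₀)) ∂(PosMat.convPow μ n) ∂μ) atTop
        (𝓝 (∫ g, ∫ x, f (act g x) ∂ν ∂μ)) := by
      refine tendsto_integral_of_dominated_convergence (fun _ => ‖f‖) (fun n => ?_)
        (integrable_const _) (fun n => Eventually.of_forall fun g => ?_)
        (Eventually.of_forall fun g => ?_)
      · have hm : StronglyMeasurable fun q : G d × G d => f (act q.1 (act q.2 x₀)) :=
          (f.continuous.measurable.comp (measurable_act_comp measurable_fst
            ((hF x₀).measurable.comp measurable_snd))).stronglyMeasurable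
        exact hm.integral_prod_right'.aestronglyMeasurable
      · refine (norm_integral_le_of_norm_le_const (C := ‖f‖)
          (Eventually.of_forall fun k => f.norm_coe_le_norm _)).trans (by simp)
      · exact hlim (f.compContinuous ⟨_, continuous_act_right g⟩) x₀
    refine tendsto_nhds_unique h1 (((hlim f x₀).comp (tendsto_add_atTop_nat 1)).congr fun n => ?_)
    simp only [Function.comp_apply]
    rw [convPow_succ']
    refine (integral_mconv_of_bounded μ _ (f.compContinuous ⟨_, hF x₀⟩)).trans ?_
    simp only [BoundedContinuousFunction.compContinuous_apply, ContinuousMap.coe_mk, act_mul]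
  · have := hν'.1
    refine ext_of_forall_integral_eq_of_IsFiniteMeasure fun f => ?_
    -- Uniqueness: `ν'` is unchanged by `n` steps, while `n` steps from any starting point converge
    -- in law to `ν`.
    have heq : ∀ n, ∫ x, ∫ g, f (act g x) ∂(PosMat.convPow μ n) ∂ν' = ∫ y, f y ∂ν' := by
      intro n
      conv_rhs => rw [← (isInvariantProb_iff.1 (hν'.convPow n)).2]
      rw [integral_prod_act]
      exact integral_integral_swap (f := fun x g => f (act g x))
        (((f.compContinuous ⟨_, continuous_act⟩).integrable
          ((PosMat.convPow μ n).prod ν')).swap :)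
    have h1 : Tendsto (fun n => ∫ x, ∫ g, f (act g x) ∂(PosMat.convPow μ n) ∂ν') atTop
        (𝓝 (∫ _, ∫ y, f y ∂ν ∂ν')) := by
      refine tendsto_integral_of_dominated_convergence (fun _ => ‖f‖) (fun n => ?_)
        (integrable_const _) (fun n => Eventually.of_forall fun x => ?_)
        (Eventually.of_forall fun x => hlim f x)
      · have hm : StronglyMeasurable fun q : SPlus d × G d => f (act q.2 q.1) :=
          (f.continuous.measurable.comp
            (measurable_act_comp measurable_snd measurable_fst)).stronglyMeasurable
        exact hm.integral_prod_right'.aestronglyMeasurable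
      · refine (norm_integral_le_of_norm_le_const (C := ‖f‖)
          (Eventually.of_forall fun k => f.norm_coe_le_norm _)).trans (by simp)
    simp only [heq] at h1
    simpa using tendsto_nhds_unique tendsto_const_nhds h1

/-! ### Laws of large numbers -/

theorem HasMoment.integrable_log_N {d : ℕ} [NeZero d] {μ : Measure (G d)} (hμ : HasMoment μ 1) :
    Integrable (fun g => Real.log (N g)) μ := by
  refine ⟨measurable_N.log.aestronglyMeasurable, ?_⟩
  rw [hasFiniteIntegral_iff_ofReal (Eventually.of_forall log_N_nonneg)]
  simpa [HasMoment] using hμ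

/-- The sum of the `log N (Y_i)`, which dominates the logarithms of the sizes of the products. -/
def sumLogN {d : ℕ} {Ω : Type*} (Y : ℕ → Ω → G d) (n : ℕ) (ω : Ω) : ℝ :=
  ∑ i ∈ Finset.range n, Real.log (N (Y i ω))

theorem sumLogN_add {d : ℕ} {Ω : Type*} (Y : ℕ → Ω → G d) (m n : ℕ) (ω : Ω) :
    sumLogN Y (m + n) ω = sumLogN Y m ω + sumLogN (fun k => Y (m + k)) n ω :=
  Finset.sum_range_add _ m n

theorem log_N_leftProd_le {d : ℕ} [NeZero d] {Ω : Type*} (Y : ℕ → Ω → G d) (n : ℕ) (ω : Ω) :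
    Real.log (N (leftProd Y n ω)) ≤ sumLogN Y n ω := by
  induction n with
  | zero => exact log_N_one.le
  | succ n ih =>
    have h1 := log_N_mul_le (Y n ω) (leftProd Y n ω)
    have h2 : sumLogN Y (n + 1) ω = sumLogN Y n ω + Real.log (N (Y n ω)) :=
      Finset.sum_range_succ _ n
    rw [h2]
    exact h1.trans (by linarith)

section

variable {d : ℕ} [NeZero d] {Ω : Type*} [MeasurableSpace Ω] {Y : ℕ → Ω → G d} {μ : Measure (G d)}
  [IsProbabilityMeasure μ] {P : Measure Ω} [IsProbabilityMeasure P]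

theorem IsIIDSeq.identDistrib_log_N (h : IsIIDSeq Y μ P) (i : ℕ) :
    IdentDistrib (fun ω => Real.log (N (Y i ω))) (fun ω => Real.log (N (Y 0 ω))) P P :=
  IdentDistrib.comp (u := fun g => Real.log (N g))
    ⟨(h.meas i).aemeasurable, (h.meas 0).aemeasurable, (h.law i).trans (h.law 0).symm⟩
    measurable_N.log

theorem IsIIDSeq.integrable_log_N (h : IsIIDSeq Y μ P) (hμ : HasMoment μ 1) (i : ℕ) :
    Integrable (fun ω => Real.log (N (Y i ω))) P := by
  have := hμ.integrable_log_N
  rw [← h.law i] at this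
  exact this.comp_measurable (h.meas i)

theorem IsIIDSeq.integrable_sumLogN (h : IsIIDSeq Y μ P) (hμ : HasMoment μ 1) (n : ℕ) :
    Integrable (sumLogN Y n) P :=
  integrable_finsetSum _ fun i _ => h.integrable_log_N hμ i

theorem IsIIDSeq.ae_tendsto_sumLogN (h : IsIIDSeq Y μ P) (hμ : HasMoment μ 1) :
    ∀ᵐ ω ∂P, Tendsto (fun n : ℕ => sumLogN Y n ω / n) atTop
      (𝓝 (∫ ω, Real.log (N (Y 0 ω)) ∂P)) :=
  strong_law_ae_real (fun i ω => Real.log (N (Y i ω))) (h.integrable_log_N hμ 0)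
    (fun _ _ hij => (h.indep.indepFun hij).comp (measurable_N.log) (measurable_N.log))
    h.identDistrib_log_N

theorem IsIIDSeq.unifIntegrable_sumLogN (h : IsIIDSeq Y μ P) (hμ : HasMoment μ 1) :
    UnifIntegrable (fun (n : ℕ) ω => sumLogN Y n ω / n) 1 P := by
  have h1 : UniformIntegrable (fun i ω => Real.log (N (Y i ω))) 1 P :=
    MemLp.uniformIntegrable_of_identDistrib le_rfl ENNReal.one_ne_top (j := 0)
      (memLp_one_iff_integrable.2 (h.integrable_log_N hμ 0)) h.identDistrib_log_N
  have h2 := (uniformIntegrable_average_real le_rfl h1).2.1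
  convert h2 using 3 with n ω
  simp [sumLogN]

/-- Random variables dominated by `sumLogN Y n / n` that converge almost surely also converge in
`L¹`. -/
theorem IsIIDSeq.tendstoAsAndL1 (h : IsIIDSeq Y μ P) (hμ : HasMoment μ 1) {X : ℕ → Ω → ℝ} {c : ℝ}
    (hX : ∀ n, AEStronglyMeasurable (X n) P) (hle : ∀ n ω, |X n ω| ≤ sumLogN Y n ω / n)
    (hc : ∀ᵐ ω ∂P, Tendsto (fun n => X n ω) atTop (𝓝 c)) : TendstoAsAndL1 P X c := by
  have hn : ∀ n ω, ‖X n ω‖ ≤ ‖sumLogN Y n ω / n‖ := fun n ω =>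
    (hle n ω).trans (le_abs_self _)
  refine ⟨hc, fun n => ?_, ?_⟩
  · exact memLp_one_iff_integrable.2 (((h.integrable_sumLogN hμ n).div_const (n : ℝ)).mono (hX n)
      (Eventually.of_forall (hn n)))
  -- Vitali's theorem; uniform integrability is inherited from the dominating averages.
  · refine tendsto_Lp_finite_of_tendsto_ae (g := fun _ => c) le_rfl ENNReal.one_ne_top hX
      (memLp_const c) (fun ε hε => ?_) hc
    obtain ⟨δ, hδ, hδ'⟩ := h.unifIntegrable_sumLogN hμ hε
    refine ⟨δ, hδ, fun n s hs hPs => (eLpNorm_mono fun ω => ?_).trans (hδ' n s hs hPs)⟩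
    by_cases hω : ω ∈ s
    · simpa only [Set.indicator_of_mem hω] using hn n ω
    · simp [Set.indicator_of_notMem hω]

/-! ### Blocks of length `m` and subadditive functions -/

theorem tendsto_mul_div_div {m : ℕ} (hm : 0 < m) :
    Tendsto (fun n : ℕ => ((m * (n / m) : ℕ) : ℝ) / n) atTop (𝓝 1) := by
  have h1 : Tendsto (fun n : ℕ => 1 - (m : ℝ) / n) atTop (𝓝 1) := by
    simpa using tendsto_const_nhds.sub (tendsto_const_div_atTop_nhds_zero_nat (m : ℝ))
  refine tendsto_of_tendsto_of_tendsto_of_le_of_le' h1 tendsto_const_nhds ?_ ?_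
  · filter_upwards [eventually_gt_atTop 0] with n hn
    have hn' : (0 : ℝ) < n := by exact_mod_cast hn
    have h2 : n ≤ m * (n / m) + m := by
      have := Nat.div_add_mod n m
      have := Nat.mod_lt n hm
      omega
    have h3 : (n : ℝ) ≤ ((m * (n / m) : ℕ) : ℝ) + m := by exact_mod_cast h2
    rw [one_sub_div hn'.ne']
    gcongr
    linarith
  · filter_upwards with n
    exact div_le_one_of_le₀ (by exact_mod_cast Nat.mul_div_le n m) n.cast_nonneg

/-- The product of the `i`-th block of `m` consecutive matrices. -/
def blockProd {d : ℕ} {Ω : Type*} (Y : ℕ → Ω → G d) (m i : ℕ) (ω : Ω) : G d :=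
  leftProd (fun k => Y (m * i + k)) m ω

theorem IsIIDSeq.measurable_blockProd (h : IsIIDSeq Y μ P) (m i : ℕ) :
    Measurable (blockProd Y m i) := (h.shift (m * i)).measurable_leftProd m

theorem IsIIDSeq.map_blockProd (h : IsIIDSeq Y μ P) (m i : ℕ) :
    P.map (blockProd Y m i) = convPow μ m := (h.shift (m * i)).map_leftProd m

/-- The `i`-th block only uses indices whose quotient by `m` is `i`. -/
theorem IsIIDSeq.indepFun_blockProd (h : IsIIDSeq Y μ P) (m : ℕ) {i j : ℕ} (hij : i ≠ j) :
    IndepFun (blockProd Y m i) (blockProd Y m j) P := by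
  have hmeas : ∀ i, Measurable[sigmaOf Y {k | k / m = i}] (blockProd Y m i) := fun i =>
    PosMat.measurable_leftProd fun k hk => measurable_sigmaOf Y <| by
      have hm : 0 < m := by omega
      simp [Nat.mul_add_div hm, Nat.div_eq_of_lt hk]
  refine h.indepFun (Set.disjoint_left.2 fun k hk hk' => hij ?_) (hmeas i) (hmeas j)
  exact hk.symm.trans hk'

theorem integrable_convPow (h : IsIIDSeq Y μ P) (hμ : HasMoment μ 1) {F : G d → ℝ}
    (hF : Measurable F) (hle : ∀ g, |F g| ≤ Real.log (N g)) (m : ℕ) :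
    Integrable F (convPow μ m) := by
  rw [← h.map_leftProd m]
  refine (integrable_map_measure hF.aestronglyMeasurable
    (h.measurable_leftProd m).aemeasurable).2 ?_
  refine (h.integrable_sumLogN hμ m).mono'
    (hF.comp (h.measurable_leftProd m)).aestronglyMeasurable (Eventually.of_forall fun ω => ?_)
  exact (hle _).trans (log_N_leftProd_le Y m ω)

theorem IsIIDSeq.ae_tendsto_blockProd (h : IsIIDSeq Y μ P) (hμ : HasMoment μ 1) {F : G d → ℝ}
    (hF : Measurable F) (hle : ∀ g, |F g| ≤ Real.log (N g)) (m : ℕ) :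
    ∀ᵐ ω ∂P, Tendsto (fun n : ℕ => (∑ i ∈ Finset.range n, F (blockProd Y m i ω)) / n) atTop
      (𝓝 (∫ g, F g ∂(convPow μ m))) := by
  have hint : Integrable (fun ω => F (blockProd Y m 0 ω)) P := by
    have := integrable_convPow h hμ hF hle m
    rw [← h.map_blockProd m 0] at this
    exact this.comp_measurable (h.measurable_blockProd m 0)
  have key := strong_law_ae_real (μ := P) (fun i ω => F (blockProd Y m i ω)) hint
    (fun i j hij => (h.indepFun_blockProd m hij).comp hF hF)
    (fun i => IdentDistrib.comp (u := F) ⟨(h.measurable_blockProd m i).aemeasurable,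
      (h.measurable_blockProd m 0).aemeasurable,
      (h.map_blockProd m i).trans (h.map_blockProd m 0).symm⟩ hF)
  rwa [← h.map_blockProd m 0, integral_map (h.measurable_blockProd m 0).aemeasurable
    hF.aestronglyMeasurable]

theorem apply_leftProd_mul_le {F : G d → ℝ} (hle : ∀ g, |F g| ≤ Real.log (N g))
    (hsub : ∀ g h, F (g * h) ≤ F g + F h) (Y : ℕ → Ω → G d) (m q : ℕ) (ω : Ω) :
    F (leftProd Y (m * q) ω) ≤ ∑ i ∈ Finset.range q, F (blockProd Y m i ω) := by
  induction q with
  | zero => exact (le_abs_self _).trans ((hle _).trans log_N_one.le)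
  | succ q ih =>
    rw [Finset.sum_range_succ, mul_add, mul_one, leftProd_add, add_comm]
    exact (hsub _ _).trans (add_le_add_right ih _)

/-- For a subadditive function `F`, the sequence `F (A_n) / n` is asymptotically at most the mean
of `F` under the `m`-th convolution power, divided by `m`. -/
theorem IsIIDSeq.ae_exists_upper (h : IsIIDSeq Y μ P) (hμ : HasMoment μ 1) {F : G d → ℝ}
    (hF : Measurable F) (hle : ∀ g, |F g| ≤ Real.log (N g))
    (hsub : ∀ g h, F (g * h) ≤ F g + F h) {m : ℕ} (hm : 0 < m) :
    ∀ᵐ ω ∂P, ∃ U : ℕ → ℝ, Tendsto U atTop (𝓝 ((∫ g, F g ∂(convPow μ m)) / m)) ∧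
      ∀ n, F (leftProd Y n ω) / n ≤ U n := by
  filter_upwards [h.ae_tendsto_blockProd hμ hF hle m, h.ae_tendsto_sumLogN hμ] with ω h1 h2
  have hm0 : (m : ℝ) ≠ 0 := by exact_mod_cast hm.ne'
  -- The complete blocks, plus a bound for the incomplete last one by its share of `sumLogN`. Both
  -- quotients in that share have the same limit by the strong law, so it vanishes.
  refine ⟨fun n => (∑ i ∈ Finset.range (n / m), F (blockProd Y m i ω)) / n +
    (sumLogN Y n ω / n - sumLogN Y (m * (n / m)) ω / n), ?_, fun n => ?_⟩
  · have hq : Tendsto (fun n : ℕ => n / m) atTop atTop := Nat.tendsto_div_const_atTop hm.ne'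
    have hmq : Tendsto (fun n : ℕ => m * (n / m)) atTop atTop :=
      hq.const_mul_atTop' hm
    have h3 := ((h1.comp hq).mul ((tendsto_mul_div_div hm).div_const (m : ℝ)))
    have h4 := (h2.comp hmq).mul (tendsto_mul_div_div hm)
    have h5 := h3.add (h2.sub h4)
    rw [mul_one, sub_self, add_zero, mul_one_div] at h5
    refine h5.congr fun n => ?_
    simp only [Function.comp_apply]
    congr 1
    · rcases Nat.eq_zero_or_pos (n / m) with h0 | h0
      · simp [h0]
      · have : ((n / m : ℕ) : ℝ) ≠ 0 := by exact_mod_cast h0.ne'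
        push_cast
        field_simp
    · congr 1
      rcases Nat.eq_zero_or_pos (n / m) with h0 | h0
      · simp [h0, sumLogN]
      · have : ((m * (n / m) : ℕ) : ℝ) ≠ 0 := by exact_mod_cast (Nat.mul_pos hm h0).ne'
        field_simp
  · have hn : m * (n / m) + n % m = n := Nat.div_add_mod n m
    have hs := sumLogN_add Y (m * (n / m)) (n % m) ω
    have hl := leftProd_add Y (m * (n / m)) (n % m) ω
    rw [hn] at hs hl
    beta_reduce
    rw [hs, ← sub_div, add_sub_cancel_left, ← add_div, hl]
    refine div_le_div_of_nonneg_right ?_ n.cast_nonneg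
    refine (hsub _ _).trans ?_
    rw [add_comm]
    exact add_le_add (apply_leftProd_mul_le hle hsub Y m _ ω)
      ((le_abs_self _).trans ((hle _).trans (log_N_leftProd_le _ _ _)))

theorem IsIIDSeq.tendsto_mean_log_ratio (h : IsIIDSeq Y μ P) (hμc : StrictlyContracting μ)
    (hμ : HasMoment μ 1) :
    Tendsto (fun n : ℕ => (∫ g, Real.log (opNorm g) ∂(convPow μ n)) / n -
      (∫ g, Real.log (v g) ∂(convPow μ n)) / n) atTop (𝓝 0) := by
  have hmeas : ∀ n, Measurable (leftProd Y n) := h.measurable_leftProd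
  -- The gap is at most twice `log N`; halving it makes it dominated by `sumLogN Y n / n`.
  set X : ℕ → Ω → ℝ := fun n ω =>
    (Real.log (opNorm (leftProd Y n ω)) - Real.log (v (leftProd Y n ω))) / 2 / n with hX
  have hXm : ∀ n, AEStronglyMeasurable (X n) P := fun n =>
    ((((measurable_opNorm.comp (hmeas n)).log.sub
      (measurable_v.comp (hmeas n)).log).div_const 2).div_const (n : ℝ)).aestronglyMeasurable
  have hXle : ∀ n ω, |X n ω| ≤ sumLogN Y n ω / n := by
    intro n ω
    rw [hX, abs_div, Nat.abs_cast]
    refine div_le_div_of_nonneg_right ?_ n.cast_nonneg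
    have h1 := log_v_le_log_opNorm (leftProd Y n ω)
    have h2 := log_opNorm_le_log_N (leftProd Y n ω)
    have h3 := neg_log_v_le_log_N (leftProd Y n ω)
    have h4 := log_N_leftProd_le Y n ω
    rw [abs_of_nonneg (by linarith)]
    linarith
  have hX0 : ∀ᵐ ω ∂P, Tendsto (fun n => X n ω) atTop (𝓝 0) := by
    filter_upwards [h.ae_tendsto_log_ratio hμc] with ω hω
    have := hω.div_const 2
    rw [zero_div] at this
    exact this.congr fun n => div_right_comm _ _ _
  obtain ⟨-, hmem, hL1⟩ := h.tendstoAsAndL1 hμ hXm hXle hX0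
  have hint := (tendsto_integral_of_L1' (fun _ => (0 : ℝ))
    (integrable_zero _ _ _).aestronglyMeasurable
    (Eventually.of_forall fun n => memLp_one_iff_integrable.1 (hmem n)) hL1).const_mul 2
  rw [integral_zero, mul_zero] at hint
  refine hint.congr fun n => ?_
  have hop := integrable_convPow h hμ measurable_opNorm.log
    (fun g => abs_le_log_N g (log_v_le_log_opNorm g) le_rfl) n
  have hv := integrable_convPow h hμ measurable_v.log
    (fun g => abs_le_log_N g le_rfl (log_v_le_log_opNorm g)) n
  have hmap : ∫ g, (Real.log (opNorm g) - Real.log (v g)) ∂(convPow μ n) =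
      ∫ ω, (Real.log (opNorm (leftProd Y n ω)) - Real.log (v (leftProd Y n ω))) ∂P := by
    rw [← h.map_leftProd n]
    exact integral_map (hmeas n).aemeasurable
      (measurable_opNorm.log.sub measurable_v.log).aestronglyMeasurable
  rw [← sub_div, ← integral_sub hop hv, hmap, hX, integral_div, integral_div]
  ring

end

/-! ### The Lyapunov exponent -/

section

variable {d : ℕ} [NeZero d] {Ω : Type*} [MeasurableSpace Ω] {Y : ℕ → Ω → G d} {μ : Measure (G d)}
  [IsProbabilityMeasure μ] {P : Measure Ω} [IsProbabilityMeasure P] {ν : Measure (SPlus d)}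

theorem abs_cocycle_le (g : G d) (x : SPlus d) : |cocycle g x| ≤ Real.log (N g) :=
  abs_le_log_N g (log_v_le_cocycle g x) (cocycle_le_log_opNorm g x)

theorem measurable_cocycle_left (x : SPlus d) : Measurable fun g : G d => cocycle g x := by
  have h := measurable_cocycle.comp (measurable_id.prodMk (measurable_const (a := x)))
  exact h

theorem integrable_cocycle (hμ : HasMoment μ 1) [IsProbabilityMeasure ν] :
    Integrable (fun q : G d × SPlus d => cocycle q.1 q.2) (μ.prod ν) :=
  (hμ.integrable_log_N.comp_fst ν).mono' measurable_cocycle.aestronglyMeasurable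
    (Eventually.of_forall fun q => abs_cocycle_le q.1 q.2)

/-- Stationarity: with a starting point of law `ν`, the position after `n` steps again has law `ν`
and is independent of the next matrix. -/
theorem IsIIDSeq.map_prodMk_act (h : IsIIDSeq Y μ P) (hν : IsInvariantProb μ ν) (n : ℕ) :
    (P.prod ν).map (fun z : Ω × SPlus d => (Y n z.1, act (leftProd Y n z.1) z.2)) =
      μ.prod ν := by
  have := hν.1
  have hm : Measurable fun z : Ω × SPlus d => (Y n z.1, act (leftProd Y n z.1) z.2) :=
    ((h.meas n).comp measurable_fst).prodMk
      (measurable_act_comp ((h.measurable_leftProd n).comp measurable_fst) measurable_snd)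
  have hpair : P.map (fun ω => (Y n ω, leftProd Y n ω)) = μ.prod (convPow μ n) := by
    rw [(indepFun_iff_map_prod_eq_prod_map_map (h.meas n).aemeasurable
      (h.measurable_leftProd n).aemeasurable).1 (h.indepFun_leftProd n), h.law, h.map_leftProd]
  refine Measure.ext_of_lintegral _ fun f hf => ?_
  have hfm : Measurable fun z : (G d × G d) × SPlus d => f (z.1.1, act z.1.2 z.2) :=
    hf.comp ((measurable_fst.comp measurable_fst).prodMk
      (measurable_act_comp (measurable_snd.comp measurable_fst) measurable_snd))
  have hinner : Measurable fun q : G d × G d => ∫⁻ x, f (q.1, act q.2 x) ∂ν :=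
    hfm.lintegral_prod_right'
  calc ∫⁻ z, f z ∂((P.prod ν).map fun z : Ω × SPlus d => (Y n z.1, act (leftProd Y n z.1) z.2))
      = ∫⁻ z, f (Y n z.1, act (leftProd Y n z.1) z.2) ∂(P.prod ν) := lintegral_map hf hm
    _ = ∫⁻ ω, ∫⁻ x, f (Y n ω, act (leftProd Y n ω) x) ∂ν ∂P :=
        lintegral_prod _ (hf.comp hm).aemeasurable
    _ = ∫⁻ q, ∫⁻ x, f (q.1, act q.2 x) ∂ν ∂(P.map fun ω => (Y n ω, leftProd Y n ω)) :=
        (lintegral_map hinner ((h.meas n).prodMk (h.measurable_leftProd n))).symm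
    _ = ∫⁻ g, ∫⁻ k, ∫⁻ x, f (g, act k x) ∂ν ∂(convPow μ n) ∂μ := by
        rw [hpair, lintegral_prod _ hinner.aemeasurable]
    _ = ∫⁻ g, ∫⁻ x, f (g, x) ∂ν ∂μ := by
        refine lintegral_congr fun g => ?_
        have hg : Measurable fun x : SPlus d => f (g, x) :=
          hf.comp (measurable_const.prodMk measurable_id)
        have hga : Measurable fun q : G d × SPlus d => f (g, act q.1 q.2) := by
          have h := hg.comp measurable_act
          exact h
        rw [← (hν.convPow n).2 _ hg, lintegral_prod _ hga.aemeasurable]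
    _ = ∫⁻ z, f z ∂(μ.prod ν) := (lintegral_prod _ hf.aemeasurable).symm

theorem IsIIDSeq.integrable_cocycle_leftProd (h : IsIIDSeq Y μ P) (hμ : HasMoment μ 1)
    [IsProbabilityMeasure ν] (n : ℕ) :
    Integrable (fun z : Ω × SPlus d => cocycle (leftProd Y n z.1) z.2) (P.prod ν) := by
  have hm : Measurable fun z : Ω × SPlus d => cocycle (leftProd Y n z.1) z.2 := by
    have h := measurable_cocycle.comp
      (((h.measurable_leftProd n).comp measurable_fst).prodMk measurable_snd)
    exact h
  exact ((h.integrable_sumLogN hμ n).comp_fst ν).mono' hm.aestronglyMeasurable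
    (Eventually.of_forall fun z => (abs_cocycle_le _ _).trans (log_N_leftProd_le Y n z.1))

/-- The cocycle identity splits `σ(A_n, x)` into `n` increments, each of mean `lyapunov μ ν` by
stationarity. -/
theorem IsIIDSeq.integral_cocycle_leftProd (h : IsIIDSeq Y μ P) (hμ : HasMoment μ 1)
    (hν : IsInvariantProb μ ν) (n : ℕ) :
    ∫ z : Ω × SPlus d, cocycle (leftProd Y n z.1) z.2 ∂(P.prod ν) = n * lyapunov μ ν := by
  have := hν.1
  induction n with
  | zero =>
    have h0 : ∀ x : SPlus d, cocycle 1 x = 0 := fun x => by simp [cocycle, x.2.1]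
    simp [leftProd, h0]
  | succ n ih =>
    have hm : Measurable fun z : Ω × SPlus d => (Y n z.1, act (leftProd Y n z.1) z.2) :=
      ((h.meas n).comp measurable_fst).prodMk
        (measurable_act_comp ((h.measurable_leftProd n).comp measurable_fst) measurable_snd)
    have hmap := h.map_prodMk_act hν n
    have hint : Integrable (fun z : Ω × SPlus d =>
        cocycle (Y n z.1) (act (leftProd Y n z.1) z.2)) (P.prod ν) := by
      have h1 := integrable_cocycle (μ := μ) (ν := ν) hμ
      rw [← hmap] at h1
      have h2 := h1.comp_measurable hm
      exact h2
    have hlyap : ∫ z : Ω × SPlus d, cocycle (Y n z.1) (act (leftProd Y n z.1) z.2) ∂(P.prod ν) =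
        lyapunov μ ν := by
      rw [lyapunov, ← hmap]
      exact (integral_map hm.aemeasurable measurable_cocycle.aestronglyMeasurable).symm
    simp only [leftProd, cocycle_mul]
    rw [integral_add hint (h.integrable_cocycle_leftProd hμ n), hlyap, ih]
    push_cast
    ring

theorem IsIIDSeq.integral_leftProd_fst (h : IsIIDSeq Y μ P) [IsProbabilityMeasure ν]
    {F : G d → ℝ} (hF : Measurable F) (n : ℕ) :
    ∫ z : Ω × SPlus d, F (leftProd Y n z.1) ∂(P.prod ν) = ∫ g, F g ∂(convPow μ n) := by
  rw [integral_fun_fst (fun ω => F (leftProd Y n ω)), ← h.map_leftProd,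
    integral_map (h.measurable_leftProd n).aemeasurable hF.aestronglyMeasurable]
  simp

theorem IsIIDSeq.integrable_leftProd_fst (h : IsIIDSeq Y μ P) (hμ : HasMoment μ 1)
    [IsProbabilityMeasure ν] {F : G d → ℝ} (hF : Measurable F)
    (hle : ∀ g, |F g| ≤ Real.log (N g)) (n : ℕ) :
    Integrable (fun z : Ω × SPlus d => F (leftProd Y n z.1)) (P.prod ν) := by
  have h1 := integrable_convPow h hμ hF hle n
  rw [← h.map_leftProd n] at h1
  exact (h1.comp_measurable (h.measurable_leftProd n)).comp_fst ν

theorem abs_log_opNorm_le (g : G d) : |Real.log (opNorm g)| ≤ Real.log (N g) :=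
  abs_le_log_N g (log_v_le_log_opNorm g) le_rfl

theorem abs_log_v_le (g : G d) : |Real.log (v g)| ≤ Real.log (N g) :=
  abs_le_log_N g le_rfl (log_v_le_log_opNorm g)

theorem IsIIDSeq.lyapunov_le (h : IsIIDSeq Y μ P) (hμ : HasMoment μ 1)
    (hν : IsInvariantProb μ ν) {n : ℕ} (hn : 0 < n) :
    lyapunov μ ν ≤ (∫ g, Real.log (opNorm g) ∂(convPow μ n)) / n := by
  have := hν.1
  rw [le_div_iff₀ (by exact_mod_cast hn), mul_comm, ← h.integral_cocycle_leftProd hμ hν,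
    ← h.integral_leftProd_fst (ν := ν) measurable_opNorm.log]
  exact integral_mono (h.integrable_cocycle_leftProd hμ n)
    (h.integrable_leftProd_fst hμ measurable_opNorm.log abs_log_opNorm_le n)
    fun z => cocycle_le_log_opNorm _ _

theorem IsIIDSeq.le_lyapunov (h : IsIIDSeq Y μ P) (hμ : HasMoment μ 1)
    (hν : IsInvariantProb μ ν) {n : ℕ} (hn : 0 < n) :
    (∫ g, Real.log (v g) ∂(convPow μ n)) / n ≤ lyapunov μ ν := by
  have := hν.1
  rw [div_le_iff₀ (by exact_mod_cast hn), mul_comm, ← h.integral_cocycle_leftProd hμ hν,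
    ← h.integral_leftProd_fst (ν := ν) measurable_v.log]
  exact integral_mono (h.integrable_leftProd_fst hμ measurable_v.log abs_log_v_le n)
    (h.integrable_cocycle_leftProd hμ n) fun z => log_v_le_cocycle _ _

theorem IsIIDSeq.exists_mean_log_opNorm_lt (h : IsIIDSeq Y μ P) (hμc : StrictlyContracting μ)
    (hμ : HasMoment μ 1) (hν : IsInvariantProb μ ν) {c : ℝ} (hc : lyapunov μ ν < c) :
    ∃ m : ℕ, 0 < m ∧ (∫ g, Real.log (opNorm g) ∂(convPow μ m)) / m < c := by
  obtain ⟨m, hm, hm0⟩ := (((h.tendsto_mean_log_ratio hμc hμ).eventually_lt_const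
    (sub_pos.2 hc)).and (eventually_gt_atTop 0)).exists
  exact ⟨m, hm0, by linarith [h.le_lyapunov hμ hν hm0]⟩

theorem IsIIDSeq.exists_lt_mean_log_v (h : IsIIDSeq Y μ P) (hμc : StrictlyContracting μ)
    (hμ : HasMoment μ 1) (hν : IsInvariantProb μ ν) {c : ℝ} (hc : c < lyapunov μ ν) :
    ∃ m : ℕ, 0 < m ∧ c < (∫ g, Real.log (v g) ∂(convPow μ m)) / m := by
  obtain ⟨m, hm, hm0⟩ := (((h.tendsto_mean_log_ratio hμc hμ).eventually_lt_const
    (sub_pos.2 hc)).and (eventually_gt_atTop 0)).exists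
  exact ⟨m, hm0, by linarith [h.lyapunov_le hμ hν hm0]⟩

/-- For any `c` on either side of the exponent, some block length `m` has its normalized mean of
`log opNorm` or of `log v` strictly between the two, and the block bound for that `m` keeps the
sequence eventually on the right side of `c`. -/
theorem IsIIDSeq.tendstoAsAndL1_of_between (h : IsIIDSeq Y μ P) (hμc : StrictlyContracting μ)
    (hμ : HasMoment μ 1) (hν : IsInvariantProb μ ν) {F : G d → ℝ} (hF : Measurable F)
    (hlo : ∀ g, Real.log (v g) ≤ F g) (hup : ∀ g, F g ≤ Real.log (opNorm g)) :
    TendstoAsAndL1 P (fun n ω => F (leftProd Y n ω) / n) (lyapunov μ ν) := by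
  have hsub : ∀ g k : G d,
      -Real.log (v (g * k)) ≤ -Real.log (v g) + -Real.log (v k) := fun g k => by
    linarith [log_v_mul_ge g k]
  refine h.tendstoAsAndL1 hμ
    (fun n => ((hF.comp (h.measurable_leftProd n)).div_const (n : ℝ)).aestronglyMeasurable)
    (fun n ω => ?_) ?_
  · rw [abs_div, Nat.abs_cast]
    exact div_le_div_of_nonneg_right
      ((abs_le_log_N _ (hlo _) (hup _)).trans (log_N_leftProd_le Y n ω)) n.cast_nonneg
  -- One null set for all block lengths, since the length depends on `c`; the index is shifted
  -- because lengths must be positive.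
  · have hU := ae_all_iff.2 fun m : ℕ => h.ae_exists_upper hμ measurable_opNorm.log
      abs_log_opNorm_le log_opNorm_mul_le m.succ_pos
    have hL := ae_all_iff.2 fun m : ℕ => h.ae_exists_upper hμ
      (F := fun g => -Real.log (v g)) measurable_v.log.neg
      (fun g => (abs_neg _).trans_le (abs_log_v_le g)) hsub m.succ_pos
    filter_upwards [hU, hL] with ω hU hL
    refine tendsto_order.2 ⟨fun c hc => ?_, fun c hc => ?_⟩
    · obtain ⟨m, hm0, hm⟩ := h.exists_lt_mean_log_v hμc hμ hν hc
      obtain ⟨k, rfl⟩ := Nat.exists_eq_succ_of_ne_zero hm0.ne'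
      obtain ⟨U, hUlim, hUle⟩ := hL k
      rw [integral_neg, neg_div] at hUlim
      filter_upwards [hUlim.eventually_lt_const (neg_lt_neg hm)] with n hn
      have h1 : Real.log (v (leftProd Y n ω)) / n ≤ F (leftProd Y n ω) / n :=
        div_le_div_of_nonneg_right (hlo _) n.cast_nonneg
      have h2 := hUle n
      rw [neg_div] at h2
      linarith
    · obtain ⟨m, hm0, hm⟩ := h.exists_mean_log_opNorm_lt hμc hμ hν hc
      obtain ⟨k, rfl⟩ := Nat.exists_eq_succ_of_ne_zero hm0.ne'
      obtain ⟨U, hUlim, hUle⟩ := hU k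
      filter_upwards [hUlim.eventually_lt_const hm] with n hn
      exact ((div_le_div_of_nonneg_right (hup _) n.cast_nonneg).trans (hUle n)).trans_lt hn

end

/-! ### Uniformity in the starting point -/

/-- The distance to `c` is largest at an end of the interval containing all `cocycle g x / n`, and
both ends are attained at basis vectors. -/
theorem iSup_enorm_cocycle_eq {d : ℕ} [NeZero d] (g : G d) (n : ℕ) (c : ℝ) :
    ⨆ x : SPlus d, ‖cocycle g x / n - c‖ₑ =
      max ‖Real.log (opNorm g) / n - c‖ₑ ‖Real.log (v g) / n - c‖ₑ := by
  refine le_antisymm (iSup_le fun x => ?_) (max_le ?_ ?_)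
  · have h1 : cocycle g x / n ≤ Real.log (opNorm g) / n :=
      div_le_div_of_nonneg_right (cocycle_le_log_opNorm g x) n.cast_nonneg
    have h2 : Real.log (v g) / n ≤ cocycle g x / n :=
      div_le_div_of_nonneg_right (log_v_le_cocycle g x) n.cast_nonneg
    rcases le_total c (cocycle g x / n) with h | h
    · refine le_max_of_le_left ?_
      rw [Real.enorm_eq_ofReal_abs, Real.enorm_eq_ofReal_abs]
      refine ENNReal.ofReal_le_ofReal ?_
      rw [abs_of_nonneg (by linarith),
        abs_of_nonneg (by linarith)]
      linarith
    · refine le_max_of_le_right ?_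
      rw [Real.enorm_eq_ofReal_abs, Real.enorm_eq_ofReal_abs]
      refine ENNReal.ofReal_le_ofReal ?_
      rw [abs_of_nonpos (by linarith),
        abs_of_nonpos (by linarith)]
      linarith
  · obtain ⟨j, hj⟩ := exists_colSum_eq_opNorm g
    rw [← hj, ← cocycle_basisVec]
    exact le_iSup (fun x : SPlus d => ‖cocycle g x / n - c‖ₑ) (basisVec j)
  · obtain ⟨j, hj⟩ := exists_colSum_eq_v g
    rw [← hj, ← cocycle_basisVec]
    exact le_iSup (fun x : SPlus d => ‖cocycle g x / n - c‖ₑ) (basisVec j)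

theorem eLpNorm_max_enorm_le {Ω : Type*} [MeasurableSpace Ω] {P : Measure Ω} {a b : Ω → ℝ}
    (ha : AEStronglyMeasurable a P) :
    eLpNorm (fun ω => max ‖a ω‖ₑ ‖b ω‖ₑ) 1 P ≤ eLpNorm a 1 P + eLpNorm b 1 P := by
  simp only [eLpNorm_one_eq_lintegral_enorm, enorm_eq_self]
  rw [← lintegral_add_left' ha.enorm]
  exact lintegral_mono fun ω => max_le le_self_add le_add_self

end

end PosMat

theorem mainTheorem6 {d : ℕ} (hd : 2 ≤ d)
    (μ : Measure (PosMat.G d)) [IsProbabilityMeasure μ]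
    (hμc : PosMat.StrictlyContracting μ) (hμm : PosMat.HasMoment μ 1)
    {Ω : Type*} [MeasurableSpace Ω] (P : Measure Ω) [IsProbabilityMeasure P]
    (Y : ℕ → Ω → PosMat.G d) (hYmeas : ∀ n, Measurable (Y n))
    (hYindep : iIndepFun Y P) (hYlaw : ∀ n, P.map (Y n) = μ) :
    ∃ ν : Measure (PosMat.SPlus d),
      PosMat.IsInvariantProb μ ν ∧
      (∀ ν' : Measure (PosMat.SPlus d), PosMat.IsInvariantProb μ ν' → ν' = ν) ∧
      Integrable (fun q : PosMat.G d × PosMat.SPlus d => PosMat.cocycle q.1 q.2) (μ.prod ν) ∧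
      (∀ x : PosMat.SPlus d,
        PosMat.TendstoAsAndL1 P
          (fun n ω => PosMat.cocycle (PosMat.leftProd Y n ω) x / n) (PosMat.lyapunov μ ν)) ∧
      PosMat.TendstoAsAndL1 P
        (fun n ω => Real.log (PosMat.opNorm (PosMat.leftProd Y n ω)) / n)
        (PosMat.lyapunov μ ν) ∧
      PosMat.TendstoAsAndL1 P
        (fun n ω => Real.log (PosMat.v (PosMat.leftProd Y n ω)) / n) (PosMat.lyapunov μ ν) ∧
      PosMat.TendstoAsAndL1 P
        (fun n ω => Real.log (PosMat.kappa (PosMat.leftProd Y n ω)) / n)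
        (PosMat.lyapunov μ ν) ∧
      (∀ n : ℕ, MemLp (fun ω => ⨆ x : PosMat.SPlus d,
        ‖PosMat.cocycle (PosMat.leftProd Y n ω) x / n - PosMat.lyapunov μ ν‖ₑ) 1 P) ∧
      Tendsto (fun n : ℕ => eLpNorm (fun ω => ⨆ x : PosMat.SPlus d,
        ‖PosMat.cocycle (PosMat.leftProd Y n ω) x / n - PosMat.lyapunov μ ν‖ₑ) 1 P)
        atTop (𝓝 0) ∧
      (∀ᵐ ω ∂P, Tendsto (fun n : ℕ => ⨆ x : PosMat.SPlus d,
        ‖PosMat.cocycle (PosMat.leftProd Y n ω) x / n - PosMat.lyapunov μ ν‖ₑ)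
        atTop (𝓝 0)) := by

  have : NeZero d := ⟨by omega⟩
  have h : PosMat.IsIIDSeq Y μ P := ⟨hYmeas, hYindep, hYlaw⟩
  obtain ⟨ν, hν, huniq⟩ := h.exists_unique_isInvariantProb hμc
  have := hν.1
  have hop := h.tendstoAsAndL1_of_between hμc hμm hν PosMat.measurable_opNorm.log
    PosMat.log_v_le_log_opNorm fun _ => le_rfl
  have hv := h.tendstoAsAndL1_of_between hμc hμm hν PosMat.measurable_v.log
    (fun _ => le_rfl) PosMat.log_v_le_log_opNorm
  have hx : ∀ x : PosMat.SPlus d, PosMat.TendstoAsAndL1 P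
      (fun n ω => PosMat.cocycle (PosMat.leftProd Y n ω) x / n) (PosMat.lyapunov μ ν) := fun x =>
    h.tendstoAsAndL1_of_between (F := fun g => PosMat.cocycle g x) hμc hμm hν
      (PosMat.measurable_cocycle_left x) (fun g => PosMat.log_v_le_cocycle g x)
      (fun g => PosMat.cocycle_le_log_opNorm g x)
  have hκ := h.tendstoAsAndL1_of_between hμc hμm hν PosMat.measurable_kappa.log
    PosMat.log_v_le_log_kappa PosMat.log_kappa_le_log_opNorm
  obtain ⟨hop1, hop2, hop3⟩ := id hop
  obtain ⟨hv1, hv2, hv3⟩ := id hv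
  have hopc : ∀ n, MemLp (fun ω => Real.log (PosMat.opNorm (PosMat.leftProd Y n ω)) / n -
      PosMat.lyapunov μ ν) 1 P := fun n => (hop2 n).sub (memLp_const _)
  have hvc : ∀ n, MemLp (fun ω => Real.log (PosMat.v (PosMat.leftProd Y n ω)) / n -
      PosMat.lyapunov μ ν) 1 P := fun n => (hv2 n).sub (memLp_const _)
  have hle := fun n => PosMat.eLpNorm_max_enorm_le
    (b := fun ω => Real.log (PosMat.v (PosMat.leftProd Y n ω)) / n - PosMat.lyapunov μ ν)
    (hopc n).aestronglyMeasurable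
  refine ⟨ν, hν, huniq, PosMat.integrable_cocycle hμm,
    hx, hop, hv, hκ, ?_, ?_, ?_⟩
  -- The supremum over uncountably many `x` becomes a maximum of two random variables, which also
  -- settles its measurability.
  all_goals simp only [PosMat.iSup_enorm_cocycle_eq]
  · intro n
    exact ⟨((hopc n).aestronglyMeasurable.enorm.max
      (hvc n).aestronglyMeasurable.enorm).aestronglyMeasurable,
      (hle n).trans_lt (ENNReal.add_lt_top.2 ⟨(hopc n).2, (hvc n).2⟩)⟩
  · have hsum := hop3.add hv3
    rw [add_zero] at hsum
    exact tendsto_of_tendsto_of_tendsto_of_le_of_le tendsto_const_nhds hsum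
      (fun _ => bot_le) hle
  · have hz : ∀ {X : ℕ → ℝ}, Tendsto X atTop (𝓝 (PosMat.lyapunov μ ν)) →
        Tendsto (fun n => ‖X n - PosMat.lyapunov μ ν‖ₑ) atTop (𝓝 0) := by
      intro X hX
      have h1 := (hX.sub_const (PosMat.lyapunov μ ν)).enorm
      rwa [sub_self, enorm_zero] at h1
    filter_upwards [hop1, hv1] with ω h1 h2
    simpa using (hz h1).max (hz h2)
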